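/- Let $n,k,t$ be positive integers. A \emph{partition} is a set of pairwise disjoint non-empty sets, called its blocks; a $k$-partition is a partition with exactly $k$ blocks, and a $k$-partition of $[n]=\{1,\dots,n\}$ is one whose blocks have union $[n]$. A family $\mathcal F$ of $k$-partitions of $[n]$ is \emph{$t$-intersecting} if any two of its members have at least $t$ blocks in common; it is \emph{trivial} if there is a $t$-partition $X$ (whose blocks need not cover $[n]$) that is contained in every member of $\mathcal F$, and \emph{non-trivial} otherwise. Two families of $k$-partitions of $[n]$ are \emph{isomorphic}, written $\cong$, if some permutation of $[n]$ carries one to the other. For $m\le n$ write $[[m]]=\{\{1\},\dots,\{m\}\}$. Let $\mathcal A(n,k,t)$ be the family of all $k$-partitions $F$ of $[n]$ with $|F\cap[[t+2]]|\ge t+1$, and let $\mathcal H(n,k,t)$ be the family consisting of all $k$-partitions $F$ of $[n]$ with $[[t]]\subseteq F$ and $F\cap([[k]]\setminus[[t]])\neq\emptyset$, together with the $t$ partitions $$\bigl([[k]]\setminus\{\{i\}\}\bigr)\cup\bigl\{\{i\}\cup\{k+1,\dots,n\}\bigr\},\qquad 1\le i\le t.$$ Put $$L(k,t)=(t+1)+(k-t+1)\cdot\log_2\bigl((t+1)(k-t+1)\bigr).$$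 \textbf{Theorem.} Let $k\ge t+3$ and $n\ge 2L(k,t)$. Then $\mathcal A(n,k,t)$ and $\mathcal H(n,k,t)$ are non-trivial $t$-intersecting families of $k$-partitions of $[n]$, and every non-trivial $t$-intersecting family $\mathcal F$ of $k$-partitions of $[n]$ satisfies $$|\mathcal F|\le\max\{|\mathcal A(n,k,t)|,\,|\mathcal H(n,k,t)|\}.$$ Moreover: (i) if $k\ge 2t+3$, then equality holds if and only if $\mathcal F\cong\mathcal H(n,k,t)$; (ii) if $k\le 2t+2$, then equality holds if and only if $\mathcal F\cong\mathcal A(n,k,t)$, or $(k,t)=(4,1)$ and $\mathcal F\cong\mathcal H(n,4,1)$. -/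

import Mathlib

namespace KPartition

/-- A (partial) partition: a finite set of pairwise disjoint non-empty blocks. It need not cover
the ground set. -/
def IsPartition {n : ℕ} (P : Finset (Finset (Fin n))) : Prop :=
  (∀ B ∈ P, B.Nonempty) ∧ ∀ B ∈ P, ∀ C ∈ P, B ≠ C → Disjoint B C

instance {n : ℕ} (P : Finset (Finset (Fin n))) : Decidable (IsPartition P) := by
  unfold IsPartition
  infer_instance

/-- `⋃ P`, the union of the blocks of `P`. -/
def support {n : ℕ} (P : Finset (Finset (Fin n))) : Finset (Fin n) := P.biUnion id

/-- All partitions of the whole `n`-set `Fin n` with exactly `k` blocks. -/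
def kPartitions (n k : ℕ) : Finset (Finset (Finset (Fin n))) :=
  Finset.univ.filter fun P => IsPartition P ∧ support P = Finset.univ ∧ P.card = k

/-- Any two members of the family have at least `t` blocks in common. -/
def IsIntersecting {n : ℕ} (t : ℕ) (F : Finset (Finset (Finset (Fin n)))) : Prop :=
  ∀ P ∈ F, ∀ Q ∈ F, t ≤ (P ∩ Q).card

/-- Every member of the family contains one common `t`-partition (a partition with `t` blocks of
a subset of the ground set). -/
def IsTrivial {n : ℕ} (t : ℕ) (F : Finset (Finset (Finset (Fin n)))) : Prop :=
  ∃ X : Finset (Finset (Fin n)), IsPartition X ∧ X.card = t ∧ ∀ P ∈ F, X ⊆ P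

/-- Non-trivial `t`-intersecting families of `k`-partitions of the `n`-set. -/
def IsNontrivialIntersecting (n k t : ℕ) (F : Finset (Finset (Finset (Fin n)))) : Prop :=
  F ⊆ kPartitions n k ∧ IsIntersecting t F ∧ ¬ IsTrivial t F

/-- Two families are the same up to a permutation of the ground set. -/
def Isomorphic {n : ℕ} (F G : Finset (Finset (Finset (Fin n)))) : Prop :=
  ∃ σ : Equiv.Perm (Fin n),
    F.image (fun P => P.image fun B => B.image σ) = G

/-- The partition of the first `m` elements of the ground set into singletons. -/
def singletons (n m : ℕ) : Finset (Finset (Fin n)) :=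
  (Finset.univ.filter fun i : Fin n => i.val < m).image fun i => {i}

/-- The `k`-partitions sharing at least `t + 1` blocks with `Z` (a `(t + 2)`-partition). -/
def familyA (n k t : ℕ) (Z : Finset (Finset (Fin n))) : Finset (Finset (Finset (Fin n))) :=
  (kPartitions n k).filter fun P => t + 1 ≤ (P ∩ Z).card

/-- The `k`-partitions that contain `X` and a block of `M \ X`, together with the partitions
obtained from `M` by enlarging one block of `X` by all elements that `M` leaves uncovered
(here `M` is a `k`-partition of a subset of the ground set and `X ⊆ M`). -/
def familyH (n k : ℕ) (X M : Finset (Finset (Fin n))) : Finset (Finset (Finset (Fin n))) :=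
  ((kPartitions n k).filter fun P => X ⊆ P ∧ (P ∩ (M \ X)).Nonempty) ∪
    X.image fun B => insert (B ∪ (support M)ᶜ) (M.erase B)

/-- The Frankl-type family. -/
def frankl (n k t : ℕ) : Finset (Finset (Finset (Fin n))) :=
  familyA n k t (singletons n (t + 2))

/-- The Hilton–Milner-type family. -/
def hiltonMilner (n k t : ℕ) : Finset (Finset (Finset (Fin n))) :=
  familyH n k (singletons n t) (singletons n k)

/-- The threshold `(t + 1) + (k - t + 1) * log₂ ((t + 1) * (k - t + 1))`. -/
noncomputable def threshold (k t : ℕ) : ℝ :=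
  ((t : ℝ) + 1) + ((k : ℝ) - t + 1) * Real.logb 2 (((t : ℝ) + 1) * ((k : ℝ) - t + 1))

end KPartition

/-!
The idea is that prescribing one more block costs a large factor. The number of
`k`-partitions containing a given partition `Y` is a Stirling number (`card_star_kPartitions`), it
is at most `extensionCount n k |Y|`, the value for singletons, if `|Y| < k`, and above the
threshold `extensionCount n k i` is at least `((t + 1) * (k - t + 1)) ^ 2` times
`extensionCount n k (i + 1)` (`sq_mul_stirlingSecond_le`). The growth estimate behind this is
`(2 ^ (m / j) - 1) * S(m, j) ≤ S(m + 1, j + 1)`, proved by induction from the recurrence and the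
concavity of `x ↦ x ^ θ`.

Call a set of blocks a cover of the family `F` if it shares at least `t` blocks with every member.
If `X` shares fewer than `t` blocks with a cover of size at most `k`, double counting bounds the
star of `X` in `F` by `k - t + 1` times the largest star of a set `insert B X`
(`card_star_le_of_isCover`). If no cover has size `t + 1`, iterating this down to the minimal size
of a cover shows that `F` is too small (`card_le_of_no_cover`). Otherwise all but few members of
`F` contain a heavy set, that is, a set of `t + 1` blocks with a star so large that it must share
`t` blocks with every cover (`card_le_sum_heavy`). So heavy sets are covers and pairwise share `t`
blocks, and `F` can be large only if there are at least `max (t + 2) (k - t)` of them. They then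
lie in one `(t + 2)`-set `Z`, which puts `F` inside `familyA Z`, or contain one `t`-set `X`, which
puts `F` inside `familyH X M` for a suitable `M` (`card_le_or_subset`). A block of `Z` or `M` that
is not a singleton makes these families smaller than the extremal ones; without such a block they
are isomorphic to the extremal ones (`card_lt_max_or_isomorphic`).

This alternative, applied to the two extremal families themselves, also decides which of them is
larger, except for `k = 2 * t + 2`, where their leading terms agree and Bonferroni inequalities
decide.
-/

/-! ### Counting partitions -/

namespace KPartition

variable {n : ℕ}

lemma mem_support {P : Finset (Finset (Fin n))} {x : Fin n} :
    x ∈ support P ↔ ∃ B ∈ P, x ∈ B := by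
  simp [support]

lemma subset_support {P : Finset (Finset (Fin n))} {B : Finset (Fin n)} (hB : B ∈ P) :
    B ⊆ support P := fun _ hx => mem_support.2 ⟨B, hB, hx⟩

lemma support_insert (B : Finset (Fin n)) (P : Finset (Finset (Fin n))) :
    support (insert B P) = B ∪ support P := by
  simp [support]

lemma support_union (P Q : Finset (Finset (Fin n))) :
    support (P ∪ Q) = support P ∪ support Q := by
  ext x; simp only [mem_support, Finset.mem_union]; grind

lemma support_mono {P Q : Finset (Finset (Fin n))} (h : P ⊆ Q) : support P ⊆ support Q :=
  Finset.biUnion_subset_biUnion_of_subset_left _ h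

lemma IsPartition.mono {P Q : Finset (Finset (Fin n))} (hQ : IsPartition Q) (h : P ⊆ Q) :
    IsPartition P :=
  ⟨fun B hB => hQ.1 B (h hB), fun B hB C hC => hQ.2 B (h hB) C (h hC)⟩

lemma IsPartition.eq_of_mem {P : Finset (Finset (Fin n))} (hP : IsPartition P)
    {B C : Finset (Fin n)} (hB : B ∈ P) (hC : C ∈ P) {x : Fin n} (hxB : x ∈ B) (hxC : x ∈ C) :
    B = C := by
  by_contra h
  exact Finset.disjoint_left.1 (hP.2 B hB C hC h) hxB hxC

lemma disjoint_support {B : Finset (Fin n)} {P : Finset (Finset (Fin n))} :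
    Disjoint B (support P) ↔ ∀ C ∈ P, Disjoint B C := by
  simp [support, Finset.disjoint_biUnion_right]

lemma notMem_of_disjoint_support {B : Finset (Fin n)} {P : Finset (Finset (Fin n))}
    (hB : B.Nonempty) (h : Disjoint B (support P)) : B ∉ P := fun hBP =>
  hB.ne_empty (disjoint_self.1 (disjoint_support.1 h B hBP))

lemma IsPartition.union {P Q : Finset (Finset (Fin n))} (hP : IsPartition P) (hQ : IsPartition Q)
    (h : Disjoint (support P) (support Q)) : IsPartition (P ∪ Q) := by
  refine ⟨fun B hB => ?_, fun B hB C hC hBC => ?_⟩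
  · rcases Finset.mem_union.1 hB with hB | hB
    exacts [hP.1 B hB, hQ.1 B hB]
  · rcases Finset.mem_union.1 hB with hB | hB <;> rcases Finset.mem_union.1 hC with hC | hC
    · exact hP.2 B hB C hC hBC
    · exact h.mono (subset_support hB) (subset_support hC)
    · exact (h.mono (subset_support hC) (subset_support hB)).symm
    · exact hQ.2 B hB C hC hBC

lemma IsPartition.insert {B : Finset (Fin n)} {P : Finset (Finset (Fin n))} (hP : IsPartition P)
    (hB : B.Nonempty) (h : Disjoint B (support P)) : IsPartition (insert B P) := by
  rw [Finset.insert_eq]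
  refine IsPartition.union ⟨by simpa using hB, by simp⟩ hP ?_
  simpa [support] using h

lemma IsPartition.disjoint_sdiff {P Y : Finset (Finset (Fin n))} (hP : IsPartition P)
    (hY : Y ⊆ P) : Disjoint (support Y) (support (P \ Y)) := by
  rw [Finset.disjoint_left]
  intro x hx hx'
  obtain ⟨B, hB, hxB⟩ := mem_support.1 hx
  obtain ⟨C, hC, hxC⟩ := mem_support.1 hx'
  rw [Finset.mem_sdiff] at hC
  exact hC.2 (hP.eq_of_mem (hY hB) hC.1 hxB hxC ▸ hB)

lemma IsPartition.support_sdiff {P Y : Finset (Finset (Fin n))} (hP : IsPartition P)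
    (hY : Y ⊆ P) : support (P \ Y) = support P \ support Y := by
  have h := support_union Y (P \ Y)
  rw [Finset.union_sdiff_of_subset hY] at h
  rw [h, Finset.union_sdiff_cancel_left (hP.disjoint_sdiff hY)]

lemma IsPartition.disjoint_erase {P : Finset (Finset (Fin n))} {B : Finset (Fin n)}
    (hP : IsPartition P) (hB : B ∈ P) : Disjoint B (support (P.erase B)) :=
  disjoint_support.2 fun C hC =>
    hP.2 B hB C (Finset.mem_of_mem_erase hC) (Finset.ne_of_mem_erase hC).symm

lemma IsPartition.support_erase {P : Finset (Finset (Fin n))} {B : Finset (Fin n)}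
    (hP : IsPartition P) (hB : B ∈ P) : support (P.erase B) = support P \ B := by
  have h := support_insert B (P.erase B)
  rw [Finset.insert_erase hB] at h
  rw [h, Finset.union_sdiff_cancel_left (hP.disjoint_erase hB)]

lemma IsPartition.card_support {P : Finset (Finset (Fin n))} (hP : IsPartition P) :
    (support P).card = ∑ B ∈ P, B.card :=
  Finset.card_biUnion fun B hB C hC h => hP.2 B hB C hC h

lemma IsPartition.card_le_card_support {P : Finset (Finset (Fin n))} (hP : IsPartition P) :
    P.card ≤ (support P).card := by
  rw [hP.card_support, Finset.card_eq_sum_ones]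
  exact Finset.sum_le_sum fun B hB => (hP.1 B hB).card_pos

/-- The partitions of the finite set `U` into `j` blocks. -/
def partitionsOf (U : Finset (Fin n)) (j : ℕ) : Finset (Finset (Finset (Fin n))) :=
  Finset.univ.filter fun P => IsPartition P ∧ support P = U ∧ P.card = j

lemma mem_partitionsOf {U : Finset (Fin n)} {j : ℕ} {P : Finset (Finset (Fin n))} :
    P ∈ partitionsOf U j ↔ IsPartition P ∧ support P = U ∧ P.card = j := by
  simp [partitionsOf]

lemma isPartition_empty : IsPartition (∅ : Finset (Finset (Fin n))) := by
  simp [IsPartition]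

lemma card_partitionsOf_filter_mem {a : Fin n} {U : Finset (Fin n)} (ha : a ∉ U) (j : ℕ) :
    ((partitionsOf (insert a U) (j + 1)).filter ({a} ∈ ·)).card = (partitionsOf U j).card := by
  symm
  refine Finset.card_nbij' (insert {a}) (fun P => P.erase {a}) ?_ ?_ ?_ ?_
  · intro P hP
    obtain ⟨hP, hU, hj⟩ := mem_partitionsOf.1 hP
    have hd : Disjoint {a} (support P) := by simpa [hU] using ha
    have hn := notMem_of_disjoint_support (Finset.singleton_nonempty a) hd
    simp only [Finset.coe_filter, Set.mem_ofPred_eq, mem_partitionsOf]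
    refine ⟨⟨hP.insert (Finset.singleton_nonempty a) hd, ?_, ?_⟩, Finset.mem_insert_self _ _⟩
    · rw [support_insert, hU]; rfl
    · rw [Finset.card_insert_of_notMem hn, hj]
  · intro P hP
    simp only [Finset.coe_filter, Set.mem_ofPred_eq, mem_partitionsOf] at hP
    obtain ⟨⟨hP, hU, hj⟩, haP⟩ := hP
    refine mem_partitionsOf.2 ⟨hP.mono (Finset.erase_subset _ _), ?_, ?_⟩
    · rw [hP.support_erase haP, hU]; grind
    · rw [Finset.card_erase_of_mem haP, hj]; rfl
  · intro P hP
    obtain ⟨hP, hU, hj⟩ := mem_partitionsOf.1 hP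
    have hd : Disjoint {a} (support P) := by simpa [hU] using ha
    exact Finset.erase_insert (notMem_of_disjoint_support (Finset.singleton_nonempty a) hd)
  · intro P hP
    exact Finset.insert_erase (Finset.mem_filter.1 hP).2

lemma card_partitionsOf_filter_notMem {a : Fin n} {U : Finset (Fin n)} (ha : a ∉ U) (j : ℕ) :
    ((partitionsOf (insert a U) (j + 1)).filter ({a} ∉ ·)).card =
      (j + 1) * (partitionsOf U (j + 1)).card := by
  have hs : ((partitionsOf U (j + 1)).sigma fun P => P).card =
      (j + 1) * (partitionsOf U (j + 1)).card := by
    rw [Finset.card_sigma, Finset.sum_congr rfl fun P hP => (mem_partitionsOf.1 hP).2.2]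
    simp [mul_comm]
  rw [← hs]
  symm
  refine Finset.card_bij (fun x _ => insert (insert a x.2) (x.1.erase x.2)) ?_ ?_ ?_
  · rintro ⟨P, B⟩ hPB
    obtain ⟨hP, hB⟩ := Finset.mem_sigma.1 hPB
    obtain ⟨hP, hU, hj⟩ := mem_partitionsOf.1 hP
    simp only at hB ⊢
    have hBU : B ⊆ U := hU ▸ subset_support hB
    have hd : Disjoint (insert a B) (support (P.erase B)) := by
      rw [hP.support_erase hB, hU]
      exact Finset.disjoint_left.2 (by grind)
    have hne : (insert a B).Nonempty := Finset.insert_nonempty _ _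
    refine Finset.mem_filter.2 ⟨mem_partitionsOf.2
      ⟨(hP.mono (Finset.erase_subset _ _)).insert hne hd, ?_, ?_⟩, ?_⟩
    · rw [support_insert, hP.support_erase hB, hU]
      grind
    · rw [Finset.card_insert_of_notMem (notMem_of_disjoint_support hne hd),
        Finset.card_erase_of_mem hB, hj]
      rfl
    · intro h
      rcases Finset.mem_insert.1 h with h | h
      · obtain ⟨b, hb⟩ := hP.1 B hB
        have : b ∈ ({a} : Finset (Fin n)) := h ▸ Finset.mem_insert_of_mem hb
        rw [Finset.mem_singleton] at this
        exact ha (hBU (this ▸ hb))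
      · exact ha (hU ▸ subset_support (Finset.mem_of_mem_erase h) (Finset.mem_singleton_self a))
  · rintro ⟨P, B⟩ hPB ⟨P', B'⟩ hPB' h
    obtain ⟨hP, hB⟩ := Finset.mem_sigma.1 hPB
    obtain ⟨hP, hU, hj⟩ := mem_partitionsOf.1 hP
    obtain ⟨hP', hB'⟩ := Finset.mem_sigma.1 hPB'
    obtain ⟨hP', hU', hj'⟩ := mem_partitionsOf.1 hP'
    simp only at hB hB' h
    have hn : ∀ C ∈ P, a ∉ C := fun C hC haC => ha (hU ▸ subset_support hC haC)
    have hn' : ∀ C ∈ P', a ∉ C := fun C hC haC => ha (hU' ▸ subset_support hC haC)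
    have h1 : insert a B = insert a B' := by
      have : insert a B ∈ insert (insert a B') (P'.erase B') := h ▸ Finset.mem_insert_self _ _
      rcases Finset.mem_insert.1 this with h | h
      · exact h
      · exact (hn' _ (Finset.mem_of_mem_erase h) (Finset.mem_insert_self _ _)).elim
    have h2 : B = B' := by
      rw [← Finset.erase_insert (hn B hB), h1, Finset.erase_insert (hn' B' hB')]
    subst h2
    have h3 : P.erase B = P'.erase B := by
      have e := congrArg (fun Q => Q.erase (insert a B)) h
      rwa [Finset.erase_insert, Finset.erase_insert] at e
      · exact fun h => hn' _ (Finset.mem_of_mem_erase h) (Finset.mem_insert_self _ _)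
      · exact fun h => hn _ (Finset.mem_of_mem_erase h) (Finset.mem_insert_self _ _)
    have h4 : P = P' := by rw [← Finset.insert_erase hB, h3, Finset.insert_erase hB']
    subst h4
    rfl
  · intro Q hQ
    obtain ⟨hQ, haQ⟩ := Finset.mem_filter.1 hQ
    obtain ⟨hQ, hU, hj⟩ := mem_partitionsOf.1 hQ
    obtain ⟨A, hA, haA⟩ : ∃ A ∈ Q, a ∈ A := mem_support.1 (hU ▸ Finset.mem_insert_self a U)
    have hne : (A.erase a).Nonempty := by
      rw [Finset.nonempty_iff_ne_empty, Ne, Finset.erase_eq_empty_iff]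
      rintro (rfl | rfl)
      · simp at haA
      · exact haQ hA
    have hd : Disjoint (A.erase a) (support (Q.erase A)) :=
      (hQ.disjoint_erase hA).mono_left (Finset.erase_subset _ _)
    have hnm := notMem_of_disjoint_support hne hd
    have hAU : A ⊆ insert a U := hU ▸ subset_support hA
    refine ⟨⟨insert (A.erase a) (Q.erase A), A.erase a⟩, Finset.mem_sigma.2
      ⟨mem_partitionsOf.2 ⟨(hQ.mono (Finset.erase_subset _ _)).insert hne hd, ?_, ?_⟩,
        Finset.mem_insert_self _ _⟩, ?_⟩
    · rw [support_insert, hQ.support_erase hA, hU]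
      grind
    · rw [Finset.card_insert_of_notMem hnm, Finset.card_erase_of_mem hA, hj]
      rfl
    · simp only
      rw [Finset.erase_insert hnm, Finset.insert_erase haA, Finset.insert_erase hA]

/-- A finite set with `m` elements has `stirlingSecond m j` partitions into `j` blocks. -/
lemma card_partitionsOf (U : Finset (Fin n)) (j : ℕ) :
    (partitionsOf U j).card = Nat.stirlingSecond U.card j := by
  induction U using Finset.induction_on generalizing j with
  | empty =>
    have h0 : ∀ P : Finset (Finset (Fin n)), IsPartition P → support P = ∅ → P = ∅ := by
      intro P hP h
      by_contra hne
      obtain ⟨B, hB⟩ := Finset.nonempty_iff_ne_empty.2 hne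
      exact (hP.1 B hB).ne_empty (Finset.subset_empty.1 (h ▸ subset_support hB))
    cases j with
    | zero =>
      have : partitionsOf (∅ : Finset (Fin n)) 0 = {∅} := by
        ext P
        simp only [mem_partitionsOf, Finset.card_eq_zero, Finset.mem_singleton]
        refine ⟨fun h => h.2.2, ?_⟩
        rintro rfl
        exact ⟨isPartition_empty, rfl, rfl⟩
      simp [this]
    | succ j =>
      have : partitionsOf (∅ : Finset (Fin n)) (j + 1) = ∅ := by
        refine Finset.eq_empty_of_forall_notMem fun P hP => ?_
        obtain ⟨h1, h2, h3⟩ := mem_partitionsOf.1 hP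
        rw [h0 P h1 h2] at h3
        simp at h3
      simp [this]
  | insert a U ha ih =>
    rw [Finset.card_insert_of_notMem ha]
    cases j with
    | zero =>
      have : partitionsOf (insert a U) 0 = ∅ := by
        refine Finset.eq_empty_of_forall_notMem fun P hP => ?_
        obtain ⟨-, h2, h3⟩ := mem_partitionsOf.1 hP
        rw [Finset.card_eq_zero] at h3
        subst h3
        exact Finset.insert_ne_empty a U h2.symm
      simp [this]
    | succ j =>
      rw [Nat.stirlingSecond_succ_succ, ← ih, ← ih, ← card_partitionsOf_filter_notMem ha,
        ← card_partitionsOf_filter_mem ha]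
      have h := Finset.card_filter_add_card_filter_not (s := partitionsOf (insert a U) (j + 1))
        (fun P => {a} ∈ P)
      omega

lemma mem_kPartitions {k : ℕ} {P : Finset (Finset (Fin n))} :
    P ∈ kPartitions n k ↔ IsPartition P ∧ support P = Finset.univ ∧ P.card = k := by
  simp [kPartitions]

/-- The members of the family `F` that contain `Y`. -/
def star (F : Finset (Finset (Finset (Fin n)))) (Y : Finset (Finset (Fin n))) :
    Finset (Finset (Finset (Fin n))) :=
  F.filter (Y ⊆ ·)

lemma mem_star {F : Finset (Finset (Finset (Fin n)))} {Y P : Finset (Finset (Fin n))} :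
    P ∈ star F Y ↔ P ∈ F ∧ Y ⊆ P := by
  simp [star]

lemma star_mono {F G : Finset (Finset (Finset (Fin n)))} (h : F ⊆ G)
    (Y : Finset (Finset (Fin n))) : star F Y ⊆ star G Y :=
  Finset.filter_subset_filter _ h

/-- The `k`-partitions containing a given partition `Y` correspond to the partitions of the
complement of the support of `Y` into `k - |Y|` blocks. -/
lemma card_star_kPartitions {k : ℕ} {Y : Finset (Finset (Fin n))} (hY : IsPartition Y)
    (hk : Y.card ≤ k) :
    (star (kPartitions n k) Y).card =
      Nat.stirlingSecond (n - (support Y).card) (k - Y.card) := by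
  have hc : ((support Y)ᶜ).card = n - (support Y).card := by
    rw [Finset.card_compl, Fintype.card_fin]
  rw [← hc, ← card_partitionsOf]
  refine Finset.card_nbij' (· \ Y) (Y ∪ ·) ?_ ?_ ?_ ?_
  · intro P hP
    obtain ⟨hP, hYP⟩ := mem_star.1 hP
    obtain ⟨hP, hU, hj⟩ := mem_kPartitions.1 hP
    refine mem_partitionsOf.2 ⟨hP.mono Finset.sdiff_subset, ?_, ?_⟩
    · rw [hP.support_sdiff hYP, hU, Finset.compl_eq_univ_sdiff]
    · rw [Finset.card_sdiff_of_subset hYP, hj]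
  · intro P hP
    obtain ⟨hP, hU, hj⟩ := mem_partitionsOf.1 hP
    have hd : Disjoint (support Y) (support P) := hU ▸ disjoint_compl_right
    refine mem_star.2 ⟨mem_kPartitions.2 ⟨hY.union hP hd, ?_, ?_⟩, Finset.subset_union_left⟩
    · rw [support_union, hU, Finset.union_compl]
    · rw [Finset.card_union_of_disjoint, hj]
      · omega
      · exact Finset.disjoint_left.2 fun B hB hB' =>
          notMem_of_disjoint_support (hY.1 B hB) (hd.mono_left (subset_support hB)) hB'
  · intro P hP
    exact Finset.union_sdiff_of_subset (mem_star.1 hP).2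
  · intro P hP
    obtain ⟨hP, hU, hj⟩ := mem_partitionsOf.1 hP
    have hd : Disjoint (support Y) (support P) := hU ▸ disjoint_compl_right
    refine Finset.union_sdiff_cancel_left (Finset.disjoint_left.2 fun B hB hB' =>
      notMem_of_disjoint_support (hY.1 B hB) (hd.mono_left (subset_support hB)) hB')

end KPartition

/-! ### Growth of Stirling numbers -/

namespace KPartition

/-- Secant slopes of the concave function `x ↦ x ^ θ` from the point `1` decrease. -/
lemma rpow_sub_one_le {b θ : ℝ} (hb : 2 ≤ b) (h0 : 0 ≤ θ) (h1 : θ ≤ 1) :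
    b ^ θ - 1 ≤ ((2 : ℝ) ^ θ - 1) * (b - 1) := by
  have h := (Real.concaveOn_rpow h0 h1).neg.secant_mono (a := 1) (x := 2) (y := b)
    (by simp) (by simp) (by simp; linarith) (by norm_num) (by linarith) hb
  simp only [Pi.neg_apply, Real.one_rpow] at h
  rw [div_le_div_iff₀ (by norm_num) (by linarith)] at h
  linarith

/-- Passing from `(m, j)` to `(m + 1, j + 1)` multiplies a Stirling number by at least
`2 ^ (m / j) - 1`, with equality for `j = 1` and for `m = j`. -/
lemma rpow_mul_stirlingSecond_le (m j : ℕ) :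
    ((2 : ℝ) ^ ((m : ℝ) / j) - 1) * Nat.stirlingSecond m j ≤
      Nat.stirlingSecond (m + 1) (j + 1) := by
  induction m generalizing j with
  | zero => simp
  | succ m ih =>
    rcases lt_trichotomy (m + 1) j with hlt | rfl | hlt
    · rw [Nat.stirlingSecond_eq_zero_of_lt hlt]
      simp
    · rw [div_self (by positivity), Nat.stirlingSecond_self, Nat.stirlingSecond_self]
      norm_num
    · match j, hlt with
      | 0, _ => simp
      | 1, hlt =>
        obtain ⟨m, rfl⟩ : ∃ m', m = m' + 1 := ⟨m - 1, by omega⟩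
        have h := ih 1
        have e := Nat.stirlingSecond_succ_succ (m + 1 + 1) 1
        rw [Nat.stirlingSecond_one_right] at e h ⊢
        rw [e]
        norm_num at h ⊢
        have hp : (2 : ℝ) ^ ((m : ℝ) + 1 + 1) = 2 * 2 ^ ((m : ℝ) + 1) := by
          rw [Real.rpow_add_one (by norm_num)]; ring
        rw [hp]
        linarith
      | j + 2, hlt =>
        have hrec := Nat.stirlingSecond_succ_succ (m + 1) (j + 2)
        have hrec' := Nat.stirlingSecond_succ_succ m (j + 1)
        have ih1 := ih (j + 2)
        have ih2 := ih (j + 1)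
        rw [hrec, hrec']
        rw [hrec'] at ih2
        set u : ℝ := (Nat.stirlingSecond m (j + 2) : ℝ) with hu
        set v : ℝ := (Nat.stirlingSecond m (j + 1) : ℝ) with hv
        set w : ℝ := (Nat.stirlingSecond (m + 1) (j + 2 + 1) : ℝ) with hw
        push_cast at ih1 ih2 ⊢
        simp only [← hu, ← hv, ← hw] at ih1 ih2 ⊢
        have hu0 : 0 ≤ u := Nat.cast_nonneg _
        have hv0 : 0 ≤ v := Nat.cast_nonneg _
        set J : ℝ := (j : ℝ) + 2 with hJ
        have hj0 : (0 : ℝ) ≤ j := Nat.cast_nonneg j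
        have hJ0 : 0 < J := by positivity
        have hmJ : J ≤ m := by
          have : j + 2 ≤ m := by omega
          rw [hJ]; exact_mod_cast this
        have hJ1 : (j : ℝ) + 1 = J - 1 := by rw [hJ]; ring
        rw [hJ1] at ih2
        set a : ℝ := 2 ^ ((m : ℝ) / J) with ha
        set b : ℝ := 2 ^ ((m : ℝ) / (J - 1)) with hb
        set p : ℝ := 2 ^ (1 / J) with hp
        have hpa : (2 : ℝ) ^ (((m : ℝ) + 1) / J) = p * a := by
          rw [hp, ha, ← Real.rpow_add (by norm_num)]
          congr 1; ring
        rw [hpa]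
        have hp0 : 0 < p := by positivity
        -- Bernoulli's inequality `2 ^ (1 / J) ≤ 1 + 1 / J`
        have hpJ : p * J ≤ J + 1 := by
          have h := _root_.rpow_one_add_le_one_add_mul_self (s := 1) (p := 1 / J) (by norm_num)
            (by positivity) (by rw [div_le_one hJ0]; linarith)
          norm_num at h
          have : p ≤ 1 + J⁻¹ := by rw [hp, one_div]; exact h
          calc p * J ≤ (1 + J⁻¹) * J := by gcongr
            _ = J + 1 := by field_simp
        have hb2 : 2 ≤ b := by
          calc (2 : ℝ) = 2 ^ (1 : ℝ) := by norm_num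
            _ ≤ b := by
              apply Real.rpow_le_rpow_of_exponent_le (by norm_num)
              rw [one_le_div (by linarith)]
              linarith
        have ha2 : 2 ≤ a := by
          calc (2 : ℝ) = 2 ^ (1 : ℝ) := by norm_num
            _ ≤ a := by
              apply Real.rpow_le_rpow_of_exponent_le (by norm_num)
              rwa [one_le_div (by linarith)]
        have hab : p * (a - 1) ≤ (2 - p) * (b - 1) := by
          have h := rpow_sub_one_le hb2 (θ := 1 - 1 / J)
            (by rw [sub_nonneg, div_le_one hJ0]; linarith) (by simp; positivity)
          have h1 : b ^ (1 - 1 / J) = a := by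
            rw [hb, ← Real.rpow_mul (by norm_num), ha]
            congr 1
            have : J - 1 ≠ 0 := by linarith
            field_simp
          have h2 : (2 : ℝ) ^ (1 - 1 / J) * p = 2 := by
            rw [hp, ← Real.rpow_add (by norm_num)]
            norm_num
          rw [h1] at h
          calc p * (a - 1) ≤ p * (((2 : ℝ) ^ (1 - 1 / J) - 1) * (b - 1)) := by gcongr
            _ = ((2 : ℝ) ^ (1 - 1 / J) * p - p) * (b - 1) := by ring
            _ = _ := by rw [h2]
        -- `u` and `v` are the terms of the recurrence `S = J * u + v` for `S = S(m + 1, J)`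
        rw [sub_add_cancel] at ih2
        have hvS : (b - 2) * v ≤ J * u := by linarith
        have hp2 : 0 ≤ 2 - p := by nlinarith
        have h1 : (p * a - 2) * v ≤ (2 - p) * (J * u) :=
          calc (p * a - 2) * v ≤ ((2 - p) * (b - 2)) * v := by gcongr; linarith
            _ = (2 - p) * ((b - 2) * v) := by ring
            _ ≤ (2 - p) * (J * u) := by gcongr
        have h2 : p * J * ((a - 1) * u) ≤ (J + 1) * w := by
          have := mul_nonneg (by linarith : 0 ≤ a - 1) hu0
          gcongr
        have h3 : (j : ℝ) + 1 + 1 = J := by rw [hJ]; ring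
        rw [h3]
        linarith

lemma three_le_logb {k t : ℕ} (ht : 1 ≤ t) (hk : t + 3 ≤ k) :
    3 ≤ Real.logb 2 (((t : ℝ) + 1) * ((k : ℝ) - t + 1)) := by
  have ht' : (1 : ℝ) ≤ t := by exact_mod_cast ht
  have hk' : (t : ℝ) + 3 ≤ k := by exact_mod_cast hk
  rw [Real.le_logb_iff_rpow_le (by norm_num) (by nlinarith)]
  norm_num
  nlinarith

lemma lt_of_threshold_le {n k t : ℕ} (ht : 1 ≤ t) (hk : t + 3 ≤ k)
    (hn : 2 * threshold k t ≤ (n : ℝ)) : k < n := by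
  have h3 := three_le_logb ht hk
  have ht' : (1 : ℝ) ≤ t := by exact_mod_cast ht
  have hk' : (t : ℝ) + 3 ≤ k := by exact_mod_cast hk
  have : (k : ℝ) < n := by
    unfold threshold at hn
    nlinarith
  exact_mod_cast this

/-- Above the threshold, each further prescribed singleton block cuts the number of partitions
by the square of `(t + 1) * (k - t + 1)`. -/
lemma sq_mul_stirlingSecond_le {n k t i : ℕ} (ht : 1 ≤ t) (hk : t + 3 ≤ k)
    (hn : 2 * threshold k t ≤ (n : ℝ)) (hi : t ≤ i) (hik : i + 2 ≤ k) :
    ((t + 1) * (k - t + 1)) ^ 2 * Nat.stirlingSecond (n - (i + 1)) (k - (i + 1)) ≤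
      Nat.stirlingSecond (n - i) (k - i) := by
  have hkn := lt_of_threshold_le ht hk hn
  obtain ⟨j, rfl⟩ : ∃ j, k = i + 1 + j := ⟨k - (i + 1), by omega⟩
  obtain ⟨m, rfl⟩ : ∃ m, n = i + 1 + m := ⟨n - (i + 1), by omega⟩
  have h3 := three_le_logb ht hk
  have hj1 : (1 : ℝ) ≤ j := by exact_mod_cast (by omega : 1 ≤ j)
  have hti : (t : ℝ) ≤ i := by exact_mod_cast hi
  have ht' : (1 : ℝ) ≤ t := by exact_mod_cast ht
  have hJ : (((i + 1 + j - t + 1 : ℕ)) : ℝ) = ((i + 1 + j : ℕ) : ℝ) - t + 1 := by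
    rw [Nat.cast_add, Nat.cast_sub (by omega)]; norm_num
  have e1 : i + 1 + m - i = m + 1 := by omega
  have e2 : i + 1 + j - i = j + 1 := by omega
  rw [Nat.add_sub_cancel_left, Nat.add_sub_cancel_left, e1, e2]
  have key := rpow_mul_stirlingSecond_le m j
  unfold threshold at hn
  set c : ℝ := ((t : ℝ) + 1) * (((i + 1 + j : ℕ) : ℝ) - t + 1) with hc
  set l : ℝ := Real.logb 2 c with hl
  have hcj : 2 * (j : ℝ) ≤ c := by
    rw [hc]; push_cast; nlinarith
  have hm : 2 * l * j + 1 ≤ m := by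
    push_cast at hn
    nlinarith [mul_nonneg (sub_nonneg.2 hti) (sub_nonneg.2 h3)]
  have hpow : c ^ 2 + 1 ≤ (2 : ℝ) ^ ((m : ℝ) / j) := by
    have h1 : 2 * l + 1 / j ≤ (m : ℝ) / j := by
      rw [le_div_iff₀ (by linarith), add_mul, one_div, inv_mul_cancel₀ (by linarith)]
      exact hm
    have h2 : (2 : ℝ) ^ (2 * l) = c ^ 2 := by
      rw [mul_comm, Real.rpow_mul (by norm_num), hl,
        Real.rpow_logb (by norm_num) (by norm_num) (by linarith)]
      norm_num
    have h3 : 1 + 1 / (2 * j) ≤ (2 : ℝ) ^ ((1 : ℝ) / j) := by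
      rw [Real.rpow_def_of_pos (by norm_num)]
      have := Real.add_one_le_exp (Real.log 2 * (1 / j))
      have hlog : (1 / 2 : ℝ) ≤ Real.log 2 := by linarith [Real.log_two_gt_d9]
      have : (1 / 2 : ℝ) * (1 / j) ≤ Real.log 2 * (1 / j) := by gcongr
      have e : (1 : ℝ) / (2 * j) = (1 / 2) * (1 / j) := by field_simp
      linarith
    calc c ^ 2 + 1 ≤ c ^ 2 * (1 + 1 / (2 * j)) := by
          have : 1 ≤ c ^ 2 * (1 / (2 * j)) := by
            rw [mul_one_div, one_le_div (by linarith)]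
            nlinarith
          linarith
      _ ≤ c ^ 2 * 2 ^ ((1 : ℝ) / j) := by gcongr
      _ = 2 ^ (2 * l + 1 / j) := by rw [Real.rpow_add (by norm_num), h2]
      _ ≤ _ := Real.rpow_le_rpow_of_exponent_le (by norm_num) h1
  have : c ^ 2 * (Nat.stirlingSecond m j : ℝ) ≤ Nat.stirlingSecond (m + 1) (j + 1) := by
    refine le_trans ?_ key
    gcongr
    linarith
  rw [hc, ← hJ] at this
  exact_mod_cast this

end KPartition

/-! ### Sizes of the families -/

namespace KPartition

variable {n : ℕ}

/-- The number of `k`-partitions of an `n`-set that contain `i` prescribed singletons, for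
`i ≤ k` and `i ≤ n`; the subtractions truncate outside this range. -/
def extensionCount (n k i : ℕ) : ℕ := Nat.stirlingSecond (n - i) (k - i)

lemma stirlingSecond_mono_left {m m' j : ℕ} (hj : 0 < j) (h : m ≤ m') :
    Nat.stirlingSecond m j ≤ Nat.stirlingSecond m' j := by
  obtain ⟨j, rfl⟩ : ∃ i, j = i + 1 := ⟨j - 1, by omega⟩
  refine monotone_nat_of_le_succ (f := fun m => Nat.stirlingSecond m (j + 1)) (fun m => ?_) h
  simp only [Nat.stirlingSecond_succ_succ]
  nlinarith [Nat.zero_le (j * Nat.stirlingSecond m (j + 1))]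

lemma stirlingSecond_pos {m j : ℕ} (hj : 0 < j) (h : j ≤ m) : 0 < Nat.stirlingSecond m j :=
  lt_of_lt_of_le (by simp [Nat.stirlingSecond_self]) (stirlingSecond_mono_left hj h)

lemma extensionCount_pos {k i : ℕ} (hi : i < k) (hk : k ≤ n) : 0 < extensionCount n k i :=
  stirlingSecond_pos (by omega) (by omega)

lemma isPartition_of_mem_star {k : ℕ} {Y P : Finset (Finset (Fin n))}
    (h : P ∈ star (kPartitions n k) Y) : IsPartition Y :=
  (mem_kPartitions.1 (mem_star.1 h).1).1.mono (mem_star.1 h).2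

lemma card_star_kPartitions_le {k : ℕ} {Y : Finset (Finset (Fin n))} (hk : Y.card < k) :
    (star (kPartitions n k) Y).card ≤ extensionCount n k Y.card := by
  rcases (star (kPartitions n k) Y).eq_empty_or_nonempty with h | ⟨P, hP⟩
  · simp [h]
  · have hY := isPartition_of_mem_star hP
    rw [card_star_kPartitions hY hk.le]
    exact stirlingSecond_mono_left (by omega)
      (Nat.sub_le_sub_left hY.card_le_card_support n)

/-- A prescribed block that is not a singleton makes the star smaller by a factor of at least
the number of free blocks. -/
lemma mul_card_star_kPartitions_le {k : ℕ} {Y : Finset (Finset (Fin n))} (hk : Y.card < k)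
    {B : Finset (Fin n)} (hB : B ∈ Y) (hB2 : 2 ≤ B.card) :
    (k - Y.card) * (star (kPartitions n k) Y).card ≤ extensionCount n k Y.card := by
  rcases (star (kPartitions n k) Y).eq_empty_or_nonempty with h | ⟨P, hP⟩
  · simp [h]
  · have hY := isPartition_of_mem_star hP
    have hlt : Y.card < (support Y).card := by
      rw [hY.card_support, Finset.card_eq_sum_ones]
      exact Finset.sum_lt_sum (fun B hB => (hY.1 B hB).card_pos) ⟨B, hB, hB2⟩
    have hn : (support Y).card ≤ n := by
      simpa using Finset.card_le_univ (support Y)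
    rw [card_star_kPartitions hY hk.le]
    have h1 : Nat.stirlingSecond (n - (support Y).card) (k - Y.card) ≤
        Nat.stirlingSecond (n - (Y.card + 1)) (k - Y.card) :=
      stirlingSecond_mono_left (by omega) (by omega)
    have h2 : extensionCount n k Y.card = (k - Y.card) *
        Nat.stirlingSecond (n - (Y.card + 1)) (k - Y.card) +
        Nat.stirlingSecond (n - (Y.card + 1)) (k - Y.card - 1) := by
      rw [← Nat.stirlingSecond_succ_left _ _ (by omega), extensionCount]
      congr 1
      omega
    rw [h2]
    exact (Nat.mul_le_mul_left _ h1).trans (Nat.le_add_right _ _)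

lemma card_star_kPartitions_eq {k : ℕ} {Y : Finset (Finset (Fin n))} (hY : IsPartition Y)
    (h1 : ∀ B ∈ Y, B.card = 1) (hk : Y.card ≤ k) :
    (star (kPartitions n k) Y).card = extensionCount n k Y.card := by
  have : (support Y).card = Y.card := by
    rw [hY.card_support, Finset.sum_congr rfl h1, Finset.card_eq_sum_ones]
  rw [card_star_kPartitions hY hk, this, extensionCount]

/-- Counting the pairs of a member `P` of `G` and an `i`-subset of `P ∩ W`. -/
lemma sum_choose_card_inter {α : Type*} [DecidableEq α] (G : Finset (Finset α)) (W : Finset α)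
    (i : ℕ) : ∑ P ∈ G, (P ∩ W).card.choose i =
      ∑ Y ∈ W.powersetCard i, (G.filter (Y ⊆ ·)).card := by
  simp only [Finset.card_filter]
  rw [Finset.sum_comm]
  refine Finset.sum_congr rfl fun P _ => ?_
  rw [← Finset.card_powersetCard, ← Finset.card_filter]
  congr 1
  ext Y
  simp only [Finset.mem_powersetCard, Finset.subset_inter_iff, Finset.mem_filter]
  tauto

lemma star_star (F : Finset (Finset (Finset (Fin n)))) (X Y : Finset (Finset (Fin n))) :
    star (star F X) Y = star F (X ∪ Y) := by
  ext P
  simp only [mem_star, Finset.union_subset_iff, and_assoc]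

lemma card_familyA_le (k t : ℕ) (Z : Finset (Finset (Fin n))) :
    (familyA n k t Z).card ≤
      ∑ T ∈ Z.powersetCard (t + 1), (star (kPartitions n k) T).card := by
  simp only [star]
  rw [← sum_choose_card_inter, familyA, Finset.card_filter]
  refine Finset.sum_le_sum fun P _ => ?_
  split_ifs with h
  · exact Nat.choose_pos h
  · exact Nat.zero_le _

lemma card_familyA {k t : ℕ} {Z : Finset (Finset (Fin n))} (hZ : IsPartition Z)
    (h1 : ∀ B ∈ Z, B.card = 1) (hc : Z.card = t + 2) (hk : t + 2 ≤ k) :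
    (familyA n k t Z).card + (t + 1) * extensionCount n k (t + 2) =
      (t + 2) * extensionCount n k (t + 1) := by
  have key : ∀ i ≤ t + 2, ∑ P ∈ kPartitions n k, (P ∩ Z).card.choose i =
      (t + 2).choose i * extensionCount n k i := by
    intro i hi
    rw [sum_choose_card_inter, ← hc, ← Finset.card_powersetCard, ← smul_eq_mul,
      ← Finset.sum_const]
    refine Finset.sum_congr rfl fun Y hY => ?_
    obtain ⟨hY, hYc⟩ := Finset.mem_powersetCard.1 hY
    have := card_star_kPartitions_eq (k := k) (hZ.mono hY) (fun B hB => h1 B (hY hB)) (by omega)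
    rw [← hYc]
    exact this
  have k1 := key (t + 1) (by omega)
  have k2 := key (t + 2) le_rfl
  rw [Nat.choose_succ_self_right] at k1
  rw [Nat.choose_self, one_mul] at k2
  rw [← k1, ← k2, familyA, Finset.card_filter, Finset.mul_sum, ← Finset.sum_add_distrib]
  refine Finset.sum_congr rfl fun P _ => ?_
  have hr : (P ∩ Z).card ≤ t + 2 := hc ▸ Finset.card_le_card Finset.inter_subset_right
  generalize (P ∩ Z).card = r at *
  rcases lt_trichotomy r (t + 1) with h | rfl | h
  · simp [Nat.choose_eq_zero_of_lt h, Nat.choose_eq_zero_of_lt (h.trans (Nat.lt_succ_self _)),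
      h.not_ge]
  · simp
  · obtain rfl : r = t + 2 := by omega
    rw [Nat.choose_succ_self_right]
    simp
    omega

/-- The `k`-partitions that contain `X` and a block of `M \ X`. -/
def familyHMain (n k : ℕ) (X M : Finset (Finset (Fin n))) : Finset (Finset (Finset (Fin n))) :=
  (star (kPartitions n k) X).filter fun P => (P ∩ (M \ X)).Nonempty

lemma familyH_eq (k : ℕ) (X M : Finset (Finset (Fin n))) :
    familyH n k X M = familyHMain n k X M ∪
      X.image fun B => insert (B ∪ (support M)ᶜ) (M.erase B) := by
  rw [familyH, familyHMain, star, Finset.filter_filter]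

lemma card_familyHMain_le (k : ℕ) (X M : Finset (Finset (Fin n))) :
    (familyHMain n k X M).card ≤ ∑ B ∈ M \ X, (star (kPartitions n k) (insert B X)).card := by
  have h : familyHMain n k X M ⊆ (M \ X).biUnion fun B => star (kPartitions n k) (insert B X) := by
    intro P hP
    obtain ⟨hP, B, hB⟩ := Finset.mem_filter.1 hP
    obtain ⟨hBP, hB⟩ := Finset.mem_inter.1 hB
    obtain ⟨hP, hX⟩ := mem_star.1 hP
    exact Finset.mem_biUnion.2 ⟨B, hB, mem_star.2 ⟨hP, Finset.insert_subset hBP hX⟩⟩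
  exact (Finset.card_le_card h).trans Finset.card_biUnion_le

lemma card_familyH_le (k : ℕ) (X M : Finset (Finset (Fin n))) :
    (familyH n k X M).card ≤ (familyHMain n k X M).card + X.card := by
  rw [familyH_eq]
  exact (Finset.card_union_le _ _).trans (Nat.add_le_add_left Finset.card_image_le _)

lemma sum_choose_star {k : ℕ} {X M : Finset (Finset (Fin n))} (hM : IsPartition M)
    (h1 : ∀ B ∈ M, B.card = 1) (hX : X ⊆ M) (hc : M.card = k) (i : ℕ) :
    ∑ P ∈ star (kPartitions n k) X, (P ∩ (M \ X)).card.choose i =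
      (k - X.card).choose i * extensionCount n k (X.card + i) := by
  have hcX := Finset.card_le_card hX
  rw [sum_choose_card_inter, ← hc, ← Finset.card_sdiff_of_subset hX, ← Finset.card_powersetCard,
    ← smul_eq_mul, ← Finset.sum_const]
  refine Finset.sum_congr rfl fun Y hY => ?_
  obtain ⟨hY, hYc⟩ := Finset.mem_powersetCard.1 hY
  have hd : Disjoint X Y := Finset.disjoint_of_subset_right hY Finset.disjoint_sdiff
  have hs : X ∪ Y ⊆ M := Finset.union_subset hX (hY.trans Finset.sdiff_subset)
  have := card_star_kPartitions_eq (k := k) (hM.mono hs) (fun B hB => h1 B (hs hB))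
    (hc ▸ Finset.card_le_card hs)
  rw [Finset.card_union_of_disjoint hd, hYc, ← star_star] at this
  rw [hc]
  exact this

lemma le_one_add_choose_two {r : ℕ} (hr : 1 ≤ r) : r ≤ 1 + r.choose 2 := by
  induction r, hr using Nat.le_induction with
  | base => simp
  | succ r hr ih => rw [Nat.choose_succ_succ' r 1, Nat.choose_one_right]; omega

lemma one_add_choose_two_le {r : ℕ} (hr : 1 ≤ r) : 1 + r.choose 2 ≤ r + r.choose 3 := by
  obtain ⟨r, rfl⟩ : ∃ r', r = r' + 1 := ⟨r - 1, by omega⟩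
  have h1 := Nat.choose_succ_succ' r 1
  have h2 := Nat.choose_succ_succ' r 2
  norm_num at h1 h2
  omega

/-- Bonferroni lower bound of order two. -/
lemma le_card_familyHMain {k : ℕ} {X M : Finset (Finset (Fin n))} (hM : IsPartition M)
    (h1 : ∀ B ∈ M, B.card = 1) (hX : X ⊆ M) (hc : M.card = k) :
    (k - X.card) * extensionCount n k (X.card + 1) ≤ (familyHMain n k X M).card +
      (k - X.card).choose 2 * extensionCount n k (X.card + 2) := by
  have e1 := sum_choose_star hM h1 hX hc 1
  have e2 := sum_choose_star hM h1 hX hc 2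
  rw [Nat.choose_one_right] at e1
  rw [← e1, ← e2, familyHMain, Finset.card_filter, ← Finset.sum_add_distrib]
  refine Finset.sum_le_sum fun P _ => ?_
  simp only [← Finset.card_pos, Nat.choose_one_right]
  generalize (P ∩ (M \ X)).card = r
  split_ifs with h
  · exact le_one_add_choose_two h
  · omega

/-- Bonferroni upper bound of order three. -/
lemma card_familyHMain_add_le {k : ℕ} {X M : Finset (Finset (Fin n))} (hM : IsPartition M)
    (h1 : ∀ B ∈ M, B.card = 1) (hX : X ⊆ M) (hc : M.card = k) :
    (familyHMain n k X M).card + (k - X.card).choose 2 * extensionCount n k (X.card + 2) ≤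
      (k - X.card) * extensionCount n k (X.card + 1) +
      (k - X.card).choose 3 * extensionCount n k (X.card + 3) := by
  have e1 := sum_choose_star hM h1 hX hc 1
  have e2 := sum_choose_star hM h1 hX hc 2
  have e3 := sum_choose_star hM h1 hX hc 3
  rw [Nat.choose_one_right] at e1
  rw [← e1, ← e2, ← e3, familyHMain, Finset.card_filter, ← Finset.sum_add_distrib,
    ← Finset.sum_add_distrib]
  refine Finset.sum_le_sum fun P _ => ?_
  simp only [← Finset.card_pos, Nat.choose_one_right]
  generalize (P ∩ (M \ X)).card = r
  split_ifs with h
  · exact one_add_choose_two_le h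
  · obtain rfl : r = 0 := by omega
    simp

/-- For `k = 4` and a single fixed block, inclusion-exclusion is exact. -/
lemma card_familyHMain_four {X M : Finset (Finset (Fin n))} (hM : IsPartition M)
    (h1 : ∀ B ∈ M, B.card = 1) (hX : X ⊆ M) (hc : M.card = 4) (hXc : X.card = 1) (hn : 4 < n) :
    (familyHMain n 4 X M).card + 3 = 3 * extensionCount n 4 2 := by
  have e1 := sum_choose_star hM h1 hX hc 1
  have e2 := sum_choose_star hM h1 hX hc 2
  have e3 := sum_choose_star hM h1 hX hc 3
  have hr3 : ∀ P ∈ star (kPartitions n 4) X, (P ∩ (M \ X)).card ≤ 3 := fun P _ => by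
    have := Finset.card_sdiff_of_subset hX
    have := Finset.card_le_card (Finset.inter_subset_right : P ∩ (M \ X) ⊆ M \ X)
    omega
  simp only [hXc] at e1 e2 e3
  have z3 : extensionCount n 4 3 = 1 := by
    obtain ⟨m, rfl⟩ : ∃ m, n = m + 4 := ⟨n - 4, by omega⟩
    exact Nat.stirlingSecond_one_right m
  have z4 : extensionCount n 4 4 = 0 := by
    obtain ⟨m, rfl⟩ : ∃ m, n = m + 1 + 4 := ⟨n - 5, by omega⟩
    exact Nat.stirlingSecond_succ_zero m
  norm_num [Nat.choose] at e1 e2 e3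
  rw [z3] at e2
  rw [z4] at e3
  rw [← e1, show (3 : ℕ) = 3 * 1 from rfl, ← e2, familyHMain, Finset.card_filter,
    ← Finset.sum_add_distrib]
  rw [Finset.sum_eq_zero_iff] at e3
  refine Finset.sum_congr rfl fun P hP => ?_
  have h3 := hr3 P hP
  have h4 := e3 P hP
  simp only [← Finset.card_pos]
  generalize (P ∩ (M \ X)).card = r at *
  interval_cases r <;> simp_all [Nat.choose]

end KPartition

/-! ### Covers and the descent -/

namespace KPartition

variable {n : ℕ}

/-- A set `W` of blocks is a `t`-cover of `F` if it shares at least `t` blocks with every member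
of `F`. -/
def IsCover (t : ℕ) (F : Finset (Finset (Finset (Fin n)))) (W : Finset (Finset (Fin n))) : Prop :=
  ∀ P ∈ F, t ≤ (P ∩ W).card

lemma card_star_le {F : Finset (Finset (Finset (Fin n)))} {k i : ℕ} (hF : F ⊆ kPartitions n k)
    {Y : Finset (Finset (Fin n))} (hY : Y.card = i) (hk : i < k) :
    (star F Y).card ≤ extensionCount n k i := by
  subst hY
  exact (Finset.card_le_card (star_mono hF Y)).trans (card_star_kPartitions_le hk)

/-- If `X` misses the cover `W` by `e = t - |X ∩ W|` blocks, each member of the star of `X`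
contains at least `e` of the at most `k - t + e` blocks of `W \ X`, and
`k - t + e ≤ e * (k - t + 1)`. -/
lemma card_star_le_of_isCover {F : Finset (Finset (Finset (Fin n)))} {t k M : ℕ}
    {W X : Finset (Finset (Fin n))} (hW : IsCover t F W) (hk : W.card ≤ k)
    (hX : (X ∩ W).card < t) (hM : ∀ B ∈ W \ X, (star F (insert B X)).card ≤ M) :
    (star F X).card ≤ (k - t + 1) * M := by
  rcases (star F X).eq_empty_or_nonempty with h0 | ⟨P, hP⟩
  · simp [h0]
  have htk : t ≤ k := ((hW P (mem_star.1 hP).1).trans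
    (Finset.card_le_card Finset.inter_subset_right)).trans hk
  have h1 := sum_choose_card_inter (star F X) (W \ X) 1
  have h2 : (star F X).card * (t - (X ∩ W).card) ≤
      ∑ P ∈ star F X, (P ∩ (W \ X)).card.choose 1 := by
    rw [← smul_eq_mul]
    refine Finset.card_nsmul_le_sum _ _ _ fun P hP => ?_
    obtain ⟨hP, hXP⟩ := mem_star.1 hP
    have h3 : P ∩ (W \ X) = (P ∩ W) \ (X ∩ W) := by grind
    rw [Nat.choose_one_right, h3, Finset.card_sdiff_of_subset
      (Finset.inter_subset_inter_right hXP)]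
    have := hW P hP
    omega
  have h3 : ∑ Y ∈ (W \ X).powersetCard 1, ((star F X).filter (Y ⊆ ·)).card ≤
      (W \ X).card * M := by
    have h4 := Finset.sum_le_card_nsmul ((W \ X).powersetCard 1)
      (fun Y => ((star F X).filter (Y ⊆ ·)).card) M ?_
    · rwa [Finset.card_powersetCard, Nat.choose_one_right, smul_eq_mul] at h4
    intro Y hY
    obtain ⟨hY, hY1⟩ := Finset.mem_powersetCard.1 hY
    obtain ⟨B, rfl⟩ := Finset.card_eq_one.1 hY1
    refine le_trans (Finset.card_le_card fun P hP => ?_) (hM B (Finset.singleton_subset_iff.1 hY))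
    obtain ⟨hP, hB⟩ := Finset.mem_filter.1 hP
    obtain ⟨hP, hXP⟩ := mem_star.1 hP
    exact mem_star.2 ⟨hP, Finset.insert_subset (Finset.singleton_subset_iff.1 hB) hXP⟩
  have h4 : (W \ X).card ≤ (t - (X ∩ W).card) * (k - t + 1) := by
    have h5 : (W \ X).card = W.card - (X ∩ W).card := Finset.card_sdiff
    obtain ⟨e, he⟩ : ∃ e, t = (X ∩ W).card + e + 1 := ⟨t - (X ∩ W).card - 1, by omega⟩
    obtain ⟨d, rfl⟩ : ∃ d, k = t + d := ⟨k - t, by omega⟩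
    have h6 : t - (X ∩ W).card = e + 1 := by omega
    have h7 : t + d - t = d := by omega
    rw [h6, h7]
    have : (e + 1) * (d + 1) = e * d + e + d + 1 := by ring
    have : 0 ≤ e * d := Nat.zero_le _
    omega
  have h5 : (t - (X ∩ W).card) * (star F X).card ≤
      (t - (X ∩ W).card) * ((k - t + 1) * M) :=
    calc (t - (X ∩ W).card) * (star F X).card
        = (star F X).card * (t - (X ∩ W).card) := mul_comm _ _
      _ ≤ (W \ X).card * M := h2.trans (h1.le.trans h3)
      _ ≤ ((t - (X ∩ W).card) * (k - t + 1)) * M := Nat.mul_le_mul_right _ h4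
      _ = _ := mul_assoc _ _ _
  exact Nat.le_of_mul_le_mul_left h5 (by omega)

/-- Below the minimal size of a cover, every star can be split repeatedly. -/
lemma card_star_le_pow_mul {F : Finset (Finset (Finset (Fin n)))} {t k m M : ℕ}
    (hF : F ⊆ kPartitions n k) (hint : IsIntersecting t F)
    (hcov : ∀ T : Finset (Finset (Fin n)), T.card < m → ¬ IsCover t F T)
    (hM : ∀ Y : Finset (Finset (Fin n)), Y.card = m → (star F Y).card ≤ M) (d : ℕ) :
    ∀ X : Finset (Finset (Fin n)), X.card + d = m → (star F X).card ≤ (k - t + 1) ^ d * M := by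
  induction d with
  | zero => intro X hX; simpa using hM X hX
  | succ d ih =>
    intro X hX
    have h := hcov X (by omega)
    unfold IsCover at h
    push Not at h
    obtain ⟨Q, hQ, hQX⟩ := h
    have := card_star_le_of_isCover (X := X) (W := Q) (k := k) (fun P hP => hint P hP Q hQ)
      (mem_kPartitions.1 (hF hQ)).2.2.le (by rwa [Finset.inter_comm]) (fun B hB =>
        ih (insert B X) (by
          rw [Finset.card_insert_of_notMem (Finset.mem_sdiff.1 hB).2]; omega))
    calc (star F X).card ≤ _ := this
      _ = _ := by ring

lemma choose_le_succ_pow (t e : ℕ) : (t + e).choose t ≤ (t + 1) ^ e := by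
  induction e with
  | zero => simp
  | succ e ih =>
    have h := Nat.choose_mul_succ_eq (t + e) t
    have h2 : t + e + 1 - t = e + 1 := by omega
    rw [h2] at h
    refine le_of_mul_le_mul_right (a := e + 1) ?_ (Nat.succ_pos e)
    calc (t + (e + 1)).choose t * (e + 1) = (t + e).choose t * (t + e + 1) := h.symm
      _ ≤ (t + 1) ^ e * ((t + 1) * (e + 1)) := Nat.mul_le_mul ih (by nlinarith [Nat.zero_le (t * e)])
      _ = _ := by ring

lemma pow_mul_extensionCount_le {k t : ℕ}
    (hr : ∀ i, t ≤ i → i + 2 ≤ k →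
      ((t + 1) * (k - t + 1)) ^ 2 * extensionCount n k (i + 1) ≤ extensionCount n k i) (d : ℕ) :
    t + 1 + d < k → (((t + 1) * (k - t + 1)) ^ 2) ^ d * extensionCount n k (t + 1 + d) ≤
      extensionCount n k (t + 1) := by
  induction d with
  | zero => simp
  | succ d ih =>
    intro h
    calc _ = (((t + 1) * (k - t + 1)) ^ 2) ^ d * (((t + 1) * (k - t + 1)) ^ 2 *
          extensionCount n k (t + 1 + d + 1)) := by rw [pow_succ, mul_assoc, ← add_assoc]
      _ ≤ _ := Nat.mul_le_mul_left _ (hr (t + 1 + d) (by omega) (by omega))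
      _ ≤ _ := ih (by omega)

lemma singleton_image_isPartition (U : Finset (Fin n)) :
    IsPartition (U.image fun i => ({i} : Finset (Fin n))) := by
  constructor
  · simp
  · simp only [Finset.mem_image]
    rintro _ ⟨i, -, rfl⟩ _ ⟨j, -, rfl⟩ h
    simpa [eq_comm] using h

lemma card_singleton_image (U : Finset (Fin n)) :
    (U.image fun i => ({i} : Finset (Fin n))).card = U.card :=
  Finset.card_image_of_injective _ Finset.singleton_injective

lemma IsNontrivialIntersecting.nonempty {k t : ℕ} {F : Finset (Finset (Finset (Fin n)))}
    (hF : IsNontrivialIntersecting n k t F) (htn : t ≤ n) : F.Nonempty := by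
  by_contra h
  rw [Finset.not_nonempty_iff_eq_empty] at h
  obtain ⟨U, -, hU⟩ := Finset.exists_subset_card_eq
    (s := (Finset.univ : Finset (Fin n))) (n := t) (by simpa using htn)
  refine hF.2.2 ⟨U.image fun i => {i}, singleton_image_isPartition U, ?_, by simp [h]⟩
  rw [card_singleton_image, hU]

/-- No set of `t` blocks lies in all members of a non-trivial family. -/
lemma IsNontrivialIntersecting.exists_not_subset {k t : ℕ} {F : Finset (Finset (Finset (Fin n)))}
    (hF : IsNontrivialIntersecting n k t F) (htn : t ≤ n) {X : Finset (Finset (Fin n))}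
    (hX : X.card = t) : ∃ P ∈ F, ¬ X ⊆ P := by
  by_contra h
  push Not at h
  obtain ⟨P, hP⟩ := hF.nonempty htn
  exact hF.2.2 ⟨X, (mem_kPartitions.1 (hF.1 hP)).1.mono (h P hP), hX, h⟩

/-- A family without a cover of size `t + 1` is small. -/
lemma card_le_of_no_cover {k t : ℕ} {F : Finset (Finset (Finset (Fin n)))}
    (hF : IsNontrivialIntersecting n k t F) (hk : t + 3 ≤ k) (hkn : k < n)
    (hr : ∀ i, t ≤ i → i + 2 ≤ k →
      ((t + 1) * (k - t + 1)) ^ 2 * extensionCount n k (i + 1) ≤ extensionCount n k i)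
    (hcov : ∀ T : Finset (Finset (Fin n)), T.card = t + 1 → ¬ IsCover t F T) :
    F.card ≤ (t + 1) * extensionCount n k (t + 1) := by
  classical
  obtain ⟨P₀, hP₀⟩ := hF.nonempty (by omega)
  have hP₀c := (mem_kPartitions.1 (hF.1 hP₀)).2.2
  have hex : ∃ m, ∃ T : Finset (Finset (Fin n)), T.card = m ∧ IsCover t F T :=
    ⟨k, P₀, hP₀c, fun P hP => hF.2.1 P hP P₀ hP₀⟩
  set m := Nat.find hex with hm
  obtain ⟨T, hTm, hT⟩ := Nat.find_spec hex
  have hmin : ∀ T : Finset (Finset (Fin n)), T.card < m → ¬ IsCover t F T :=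
    fun T h hT => Nat.find_min hex h ⟨T, rfl, hT⟩
  have hmk : m ≤ k := Nat.find_min' hex ⟨P₀, hP₀c, fun P hP => hF.2.1 P hP P₀ hP₀⟩
  rw [← hm] at hTm
  have htm : t + 2 ≤ m := by
    by_contra hlt
    have h1 : m ≠ t + 1 := fun h => hcov T (hTm.trans h) hT
    have h2 : t ≤ (P₀ ∩ T).card := hT P₀ hP₀
    have h3 : (P₀ ∩ T).card ≤ T.card := Finset.card_le_card Finset.inter_subset_right
    have h4 : T.card = t := by omega
    obtain ⟨P, hP, hTP⟩ := hF.exists_not_subset (by omega) h4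
    have h5 := hT P hP
    have h6 : P ∩ T = T :=
      Finset.eq_of_subset_of_card_le Finset.inter_subset_right (by omega)
    exact hTP (h6 ▸ Finset.inter_subset_left)
  -- A `k`-partition is determined by `k - 1` of its blocks, so the descent stops there.
  obtain ⟨d, hd⟩ : ∃ d, min m (k - 1) = t + 1 + (d + 1) :=
    ⟨min m (k - 1) - t - 2, by omega⟩
  set J := k - t + 1 with hJ
  set E := extensionCount n k (t + 1 + (d + 1)) with hE
  have hstar : ∀ X ∈ T.powersetCard t, (star F X).card ≤ J ^ (d + 2) * E := by
    intro X hX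
    refine card_star_le_pow_mul hF.1 hF.2.1 (m := min m (k - 1))
      (fun T hT => hmin T (hT.trans_le (min_le_left _ _)))
      (fun Y hY => card_star_le hF.1 (hY.trans hd) (by omega)) (d + 2) X ?_
    rw [(Finset.mem_powersetCard.1 hX).2]
    omega
  have hsub : F ⊆ (T.powersetCard t).biUnion (star F) := by
    intro P hP
    obtain ⟨X, hX, hXt⟩ := Finset.exists_subset_card_eq (hT P hP)
    exact Finset.mem_biUnion.2 ⟨X, Finset.mem_powersetCard.2
      ⟨hX.trans Finset.inter_subset_right, hXt⟩, mem_star.2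
      ⟨hP, hX.trans Finset.inter_subset_left⟩⟩
  have hchoose : m.choose t ≤ (t + 1) ^ (d + 3) := by
    obtain ⟨e, he⟩ : ∃ e, m = t + e := ⟨m - t, by omega⟩
    rw [he]
    exact (choose_le_succ_pow t e).trans (Nat.pow_le_pow_right (by omega) (by omega))
  calc F.card ≤ ((T.powersetCard t).biUnion (star F)).card := Finset.card_le_card hsub
    _ ≤ (T.powersetCard t).card * (J ^ (d + 2) * E) := Finset.card_biUnion_le_card_mul _ _ _ hstar
    _ = m.choose t * (J ^ (d + 2) * E) := by rw [Finset.card_powersetCard, hTm]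
    _ ≤ (t + 1) ^ (d + 3) * (J ^ (d + 2) * E) := Nat.mul_le_mul_right _ hchoose
    _ = (t + 1) * (((t + 1) * J) ^ (d + 2) * E) := by rw [mul_pow]; ring
    _ ≤ (t + 1) * ((((t + 1) * J) ^ 2) ^ (d + 1) * E) := by
      rw [← pow_mul]
      exact Nat.mul_le_mul_left _ (Nat.mul_le_mul_right _
        (Nat.pow_le_pow_right (Nat.mul_pos (by omega) (by omega)) (by omega)))
    _ ≤ (t + 1) * extensionCount n k (t + 1) :=
      Nat.mul_le_mul_left _ (pow_mul_extensionCount_le hr (d + 1) (by omega))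

/-! ### Heavy sets of `t + 1` blocks -/

/-- The sets of `t + 1` blocks contained in more than `(k - t + 1) * extensionCount n k (t + 2)`
members of `F`. -/
def heavy (k t : ℕ) (F : Finset (Finset (Finset (Fin n)))) : Finset (Finset (Finset (Fin n))) :=
  Finset.univ.filter fun T =>
    T.card = t + 1 ∧ (k - t + 1) * extensionCount n k (t + 2) < (star F T).card

lemma mem_heavy {k t : ℕ} {F : Finset (Finset (Finset (Fin n)))} {T : Finset (Finset (Fin n))} :
    T ∈ heavy k t F ↔
      T.card = t + 1 ∧ (k - t + 1) * extensionCount n k (t + 2) < (star F T).card := by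
  simp [heavy]

/-- A heavy set shares at least `t` blocks with every cover of size at most `k`, in particular
with every member of the family; thus it is itself a cover, and heavy sets share `t` blocks. -/
lemma le_card_inter_of_mem_heavy {k t : ℕ} {F : Finset (Finset (Finset (Fin n)))}
    (hF : F ⊆ kPartitions n k) (hk : t + 3 ≤ k) {T W : Finset (Finset (Fin n))}
    (hT : T ∈ heavy k t F) (hW : IsCover t F W) (hWk : W.card ≤ k) : t ≤ (T ∩ W).card := by
  obtain ⟨hTc, hTF⟩ := mem_heavy.1 hT
  by_contra h
  refine hTF.not_ge (card_star_le_of_isCover hW hWk (not_le.1 h) fun B hB => ?_)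
  refine card_star_le hF ?_ (by omega)
  rw [Finset.card_insert_of_notMem (Finset.mem_sdiff.1 hB).2, hTc]

lemma isCover_of_mem_heavy {k t : ℕ} {F : Finset (Finset (Finset (Fin n)))}
    (hF : F ⊆ kPartitions n k) (hint : IsIntersecting t F) (hk : t + 3 ≤ k)
    {T : Finset (Finset (Fin n))} (hT : T ∈ heavy k t F) : IsCover t F T := fun P hP => by
  rw [Finset.inter_comm]
  exact le_card_inter_of_mem_heavy hF hk hT (fun Q hQ => hint Q hQ P hP)
    (mem_kPartitions.1 (hF hP)).2.2.le

lemma isPartition_of_mem_heavy {k t : ℕ} {F : Finset (Finset (Finset (Fin n)))}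
    (hF : F ⊆ kPartitions n k) {T : Finset (Finset (Fin n))} (hT : T ∈ heavy k t F) :
    IsPartition T := by
  obtain ⟨P, hP⟩ := Finset.card_pos.1 ((Nat.zero_le _).trans_lt (mem_heavy.1 hT).2)
  exact isPartition_of_mem_star (star_mono hF T hP)

/-- Up to few exceptions, every member of a family with a cover of size `t + 1` contains a
heavy set. -/
lemma card_le_sum_heavy {k t : ℕ} {F : Finset (Finset (Finset (Fin n)))}
    (hF : IsNontrivialIntersecting n k t F) (htn : t ≤ n) (hk : t + 3 ≤ k)
    {T₀ : Finset (Finset (Fin n))}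
    (hT₀ : IsCover t F T₀) (hT₀c : T₀.card = t + 1) :
    F.card ≤ (heavy k t F).card * (extensionCount n k (t + 1)) +
      (t + 1) * ((k - t + 1) * ((k - t + 1) * extensionCount n k (t + 2))) := by
  have hex : ∀ X : Finset (Finset (Fin n)), ∃ Q : Finset (Finset (Fin n)),
      X.card = t → Q ∈ F ∧ ¬ X ⊆ Q := fun X => by
    by_cases h : X.card = t
    · obtain ⟨Q, hQ⟩ := hF.exists_not_subset htn h
      exact ⟨Q, fun _ => hQ⟩
    · exact ⟨∅, fun h' => (h h').elim⟩
  choose Q hQ using hex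
  set L : Finset (Finset (Fin n)) → Finset (Finset (Fin n)) :=
    fun X => (Q X \ X).filter fun B => insert B X ∉ heavy k t F with hL
  have hsub : F ⊆ (heavy k t F).biUnion (star F) ∪
      (T₀.powersetCard t).biUnion fun X => (L X).biUnion fun B => star F (insert B X) := by
    intro P hP
    obtain ⟨X, hX, hXt⟩ := Finset.exists_subset_card_eq (hT₀ P hP)
    obtain ⟨hQF, hXQ⟩ := hQ X hXt
    have hPQ := hF.2.1 P hP (Q X) hQF
    obtain ⟨B, hB, hBX⟩ : ∃ B ∈ P ∩ Q X, B ∉ X := by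
      by_contra h
      push Not at h
      have := Finset.eq_of_subset_of_card_le h (by omega)
      exact hXQ (this.ge.trans Finset.inter_subset_right)
    have hXP : X ⊆ P := hX.trans Finset.inter_subset_left
    have hstar : P ∈ star F (insert B X) :=
      mem_star.2 ⟨hP, Finset.insert_subset (Finset.mem_inter.1 hB).1 hXP⟩
    by_cases hh : insert B X ∈ heavy k t F
    · exact Finset.mem_union_left _ (Finset.mem_biUnion.2 ⟨_, hh, hstar⟩)
    · refine Finset.mem_union_right _ (Finset.mem_biUnion.2 ⟨X, Finset.mem_powersetCard.2
        ⟨hX.trans Finset.inter_subset_right, hXt⟩, Finset.mem_biUnion.2 ⟨B, ?_, hstar⟩⟩)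
      exact Finset.mem_filter.2
        ⟨Finset.mem_sdiff.2 ⟨(Finset.mem_inter.1 hB).2, hBX⟩, hh⟩
  refine (Finset.card_le_card hsub).trans ((Finset.card_union_le _ _).trans
    (Nat.add_le_add ?_ ?_))
  · refine Finset.card_biUnion_le_card_mul _ _ _ fun T hT => ?_
    exact card_star_le hF.1 (mem_heavy.1 hT).1 (by omega)
  · have hc : (T₀.powersetCard t).card = t + 1 := by
      rw [Finset.card_powersetCard, hT₀c, Nat.choose_succ_self_right]
    rw [← hc]
    refine Finset.card_biUnion_le_card_mul _ _ _ fun X hX => ?_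
    obtain ⟨hXT, hXt⟩ := Finset.mem_powersetCard.1 hX
    have hLc : (L X).card ≤ k - t + 1 := by
      refine (Finset.card_filter_le _ _).trans ?_
      obtain ⟨hQF, -⟩ := hQ X hXt
      have h1 := hT₀ _ hQF
      have h2 : (Q X ∩ T₀).card ≤ (X ∩ Q X).card + (T₀ \ X).card := by
        rw [← Finset.card_union_of_disjoint]
        · exact Finset.card_le_card (by grind)
        · exact Finset.disjoint_left.2 (by grind)
      have h3 : (T₀ \ X).card = 1 := by
        rw [Finset.card_sdiff_of_subset hXT]; omega
      have h4 : (Q X \ X).card = (Q X).card - (X ∩ Q X).card := Finset.card_sdiff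
      have h5 := (mem_kPartitions.1 (hF.1 hQF)).2.2
      omega
    refine (Finset.card_biUnion_le_card_mul _ _ _ fun B hB => ?_).trans
      (Nat.mul_le_mul_right _ hLc)
    obtain ⟨hB, hBh⟩ := Finset.mem_filter.1 hB
    by_contra hlt
    refine hBh (mem_heavy.2 ⟨?_, not_le.1 hlt⟩)
    rw [Finset.card_insert_of_notMem (Finset.mem_sdiff.1 hB).2, hXt]

end KPartition

/-! ### The structure of large families -/

namespace KPartition

variable {n : ℕ}

/-- Sets of size `t + 1` that pairwise share `t` elements all contain a common `t`-set or all lie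
in a common `(t + 2)`-set. -/
lemma exists_core_or_hull {α : Type*} [DecidableEq α] {t : ℕ} {H : Finset (Finset α)}
    (hc : ∀ T ∈ H, T.card = t + 1) (hi : ∀ T ∈ H, ∀ T' ∈ H, t ≤ (T ∩ T').card)
    (hH : 1 < H.card) :
    (∃ X : Finset α, X.card = t ∧ ∀ T ∈ H, X ⊆ T) ∨
      ∃ Z : Finset α, Z.card = t + 2 ∧ ∀ T ∈ H, T ⊆ Z := by
  obtain ⟨A, hA, B, hB, hAB⟩ := Finset.one_lt_card.1 hH
  have hinter : ∀ T ∈ H, ∀ T' ∈ H, T ≠ T' → (T ∩ T').card = t := by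
    intro T hT T' hT' hne
    refine le_antisymm ?_ (hi T hT T' hT')
    by_contra h
    have h1 : T ∩ T' = T :=
      Finset.eq_of_subset_of_card_le Finset.inter_subset_left (by rw [hc T hT]; omega)
    have h2 : T ∩ T' = T' :=
      Finset.eq_of_subset_of_card_le Finset.inter_subset_right (by rw [hc T' hT']; omega)
    exact hne (h1.symm.trans h2)
  have hABc := hinter A hA B hB hAB
  by_cases hX : ∀ T ∈ H, A ∩ B ⊆ T
  · exact Or.inl ⟨A ∩ B, hABc, hX⟩
  · right
    push Not at hX
    obtain ⟨C, hC, hXC⟩ := hX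
    have hunion : (A ∪ B).card = t + 2 := by
      have := Finset.card_union_add_card_inter A B
      rw [hc A hA, hc B hB, hABc] at this
      omega
    have hsub : ∀ T ∈ H, ¬ A ∩ B ⊆ T → T ⊆ A ∪ B := by
      -- `T` has `t` elements in each of `A`, `B` but fewer than `t` in `A ∩ B`
      intro T hT hn
      have h1 := hi T hT A hA
      have h2 := hi T hT B hB
      have h3 : (T ∩ (A ∩ B)).card < t := by
        by_contra h
        have := Finset.eq_of_subset_of_card_le
          (Finset.inter_subset_right : T ∩ (A ∩ B) ⊆ A ∩ B) (by omega)
        exact hn (this ▸ Finset.inter_subset_left)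
      have h4 := Finset.card_union_add_card_inter (T ∩ A) (T ∩ B)
      have h5 : T ∩ A ∩ (T ∩ B) = T ∩ (A ∩ B) :=
        (Finset.inter_inter_distrib_left _ _ _).symm
      have h6 : T ∩ A ∪ T ∩ B = T ∩ (A ∪ B) :=
        (Finset.inter_union_distrib_left _ _ _).symm
      rw [h5, h6] at h4
      have h7 := Finset.eq_of_subset_of_card_le
        (Finset.inter_subset_left : T ∩ (A ∪ B) ⊆ T) (by rw [hc T hT]; omega)
      exact h7 ▸ Finset.inter_subset_right
    refine ⟨A ∪ B, hunion, fun T hT => ?_⟩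
    by_cases hn : A ∩ B ⊆ T
    · by_contra hTZ
      -- then `T` meets `A ∪ B` only in `A ∩ B`, of which `C` contains at most `t - 1` elements
      have h1 : T ∩ (A ∪ B) = A ∩ B := by
        refine (Finset.eq_of_subset_of_card_le (Finset.subset_inter hn
          (Finset.inter_subset_left.trans Finset.subset_union_left)) ?_).symm
        have : (T ∩ (A ∪ B)).card < T.card := Finset.card_lt_card
          ⟨Finset.inter_subset_left, fun h => hTZ (h.trans Finset.inter_subset_right)⟩
        rw [hc T hT] at this
        omega
      have h2 := hi T hT C hC
      have h3 : T ∩ C ⊆ A ∩ B := fun x hx => by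
        rw [Finset.mem_inter] at hx
        rw [← h1]
        exact Finset.mem_inter.2 ⟨hx.1, hsub C hC hXC hx.2⟩
      have h4 := Finset.eq_of_subset_of_card_le h3 (by omega)
      exact hXC (h4 ▸ Finset.inter_subset_right)
    · exact hsub T hT hn

/-- If the heavy sets lie in a common `(t + 2)`-set and there are enough of them, they are all its
`(t + 1)`-subsets, and the family is of Frankl type. -/
lemma subset_familyA_of_hull {k t : ℕ} {F : Finset (Finset (Finset (Fin n)))}
    (hF : IsNontrivialIntersecting n k t F) (ht : 1 ≤ t) (hk : t + 3 ≤ k)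
    {Z : Finset (Finset (Fin n))} (hZc : Z.card = t + 2) (hZ : ∀ T ∈ heavy k t F, T ⊆ Z)
    (hH : max (t + 2) (k - t) ≤ (heavy k t F).card) :
    IsPartition Z ∧ k ≤ 2 * t + 2 ∧ F ⊆ familyA n k t Z := by
  have hsub : heavy k t F ⊆ Z.powersetCard (t + 1) := fun T hT =>
    Finset.mem_powersetCard.2 ⟨hZ T hT, (mem_heavy.1 hT).1⟩
  have hcard : (Z.powersetCard (t + 1)).card = t + 2 := by
    rw [Finset.card_powersetCard, hZc, Nat.choose_succ_self_right]
  have heq := Finset.eq_of_subset_of_card_le hsub (by omega)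
  have hheavy : ∀ B ∈ Z, Z.erase B ∈ heavy k t F := fun B hB => by
    rw [heq, Finset.mem_powersetCard, Finset.card_erase_of_mem hB, hZc]
    exact ⟨Finset.erase_subset _ _, rfl⟩
  refine ⟨?_, ?_, ?_⟩
  · have hpair : ∀ B ∈ Z, ∀ C ∈ Z, ∃ T : Finset (Finset (Fin n)), IsPartition T ∧ B ∈ T ∧ C ∈ T := by
      intro B hB C hC
      obtain ⟨D, hD, hDB⟩ : ∃ D ∈ Z, D ∉ ({B, C} : Finset (Finset (Fin n))) :=
        Finset.exists_mem_notMem_of_card_lt_card (by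
          have := Finset.card_le_two (a := B) (b := C); omega)
      simp only [Finset.mem_insert, Finset.mem_singleton, not_or] at hDB
      exact ⟨Z.erase D, isPartition_of_mem_heavy hF.1 (hheavy D hD),
        Finset.mem_erase.2 ⟨Ne.symm hDB.1, hB⟩, Finset.mem_erase.2 ⟨Ne.symm hDB.2, hC⟩⟩
    refine ⟨fun B hB => ?_, fun B hB C hC hne => ?_⟩
    · obtain ⟨T, hT, hBT, -⟩ := hpair B hB B hB
      exact hT.1 B hBT
    · obtain ⟨T, hT, hBT, hCT⟩ := hpair B hB C hC
      exact hT.2 B hBT C hCT hne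
  · have := Finset.card_le_card hsub
    omega
  · intro P hP
    refine Finset.mem_filter.2 ⟨hF.1 hP, ?_⟩
    have hcov : ∀ B ∈ Z, t ≤ (P ∩ Z.erase B).card := fun B hB =>
      isCover_of_mem_heavy hF.1 hF.2.1 hk (hheavy B hB) P hP
    obtain ⟨C, hC⟩ := Finset.card_pos.1 (by omega : 0 < Z.card)
    obtain ⟨B, hB⟩ := Finset.card_pos.1 (lt_of_lt_of_le (by omega) (hcov C hC))
    obtain ⟨hBP, hB⟩ := Finset.mem_inter.1 hB
    have hBZ := Finset.mem_of_mem_erase hB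
    have h1 := hcov B hBZ
    rw [Finset.inter_erase, Finset.card_erase_of_mem (Finset.mem_inter.2 ⟨hBP, hBZ⟩)] at h1
    have : 0 < (P ∩ Z).card := Finset.card_pos.2 ⟨B, Finset.mem_inter.2 ⟨hBP, hBZ⟩⟩
    omega

/-- If the heavy sets share `t` blocks `X` and there are enough of them, the blocks that complete
`X` to a heavy set number exactly `k - t`, and the family is of Hilton–Milner type. -/
lemma subset_familyH_of_core {k t : ℕ} {F : Finset (Finset (Finset (Fin n)))}
    (hF : IsNontrivialIntersecting n k t F) (hk : t + 3 ≤ k) (htn : t ≤ n)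
    {X : Finset (Finset (Fin n))} (hXc : X.card = t) (hX : ∀ T ∈ heavy k t F, X ⊆ T)
    (hH : max (t + 2) (k - t) ≤ (heavy k t F).card) :
    ∃ M : Finset (Finset (Fin n)), IsPartition M ∧ X ⊆ M ∧ M.card = k ∧ 2 * t + 2 ≤ k ∧
      F ⊆ familyH n k X M := by
  set W : Finset (Finset (Fin n)) :=
    Finset.univ.filter fun B => B ∉ X ∧ insert B X ∈ heavy k t F with hW
  have hWmem : ∀ B, B ∈ W ↔ B ∉ X ∧ insert B X ∈ heavy k t F := fun B => by simp [hW]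
  have hWc : (heavy k t F).card ≤ W.card := by
    have : heavy k t F ⊆ W.image fun B => insert B X := by
      intro T hT
      have hXT := hX T hT
      have h1 : (T \ X).card = 1 := by
        rw [Finset.card_sdiff_of_subset hXT, (mem_heavy.1 hT).1]; omega
      obtain ⟨B, hB⟩ := Finset.card_eq_one.1 h1
      have hBX : B ∉ X := (Finset.mem_sdiff.1 (hB ▸ Finset.mem_singleton_self B)).2
      have hTe : insert B X = T := by
        rw [Finset.insert_eq, ← hB, Finset.sdiff_union_of_subset hXT]
      exact Finset.mem_image.2 ⟨B, (hWmem B).2 ⟨hBX, hTe ▸ hT⟩, hTe⟩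
    exact (Finset.card_le_card this).trans Finset.card_image_le
  have hWX : Disjoint X W := Finset.disjoint_left.2 fun B hB hBW => ((hWmem B).1 hBW).1 hB
  have hWne : W.Nonempty := Finset.card_pos.1 (by omega)
  -- a member of the family that does not contain `X` contains all of `W`
  have hout : ∀ P ∈ F, ¬ X ⊆ P → W ⊆ P ∧ (P ∩ X).card = t - 1 ∧ 1 ≤ t := by
    intro P hP hXP
    have hlt : (P ∩ X).card < t := by
      by_contra h
      have := Finset.eq_of_subset_of_card_le (Finset.inter_subset_right : P ∩ X ⊆ X) (by omega)
      exact hXP (this ▸ Finset.inter_subset_left)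
    have hB : ∀ B ∈ W, B ∈ P ∧ t ≤ (P ∩ X).card + 1 := by
      intro B hB
      obtain ⟨hBX, hBh⟩ := (hWmem B).1 hB
      have h1 := isCover_of_mem_heavy hF.1 hF.2.1 hk hBh P hP
      by_cases hBP : B ∈ P
      · rw [Finset.inter_insert_of_mem hBP] at h1
        exact ⟨hBP, h1.trans (Finset.card_insert_le _ _)⟩
      · rw [Finset.inter_insert_of_notMem hBP] at h1
        omega
    obtain ⟨B, hBW⟩ := hWne
    have := (hB B hBW).2
    exact ⟨fun B hBW => (hB B hBW).1, by omega, by omega⟩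
  obtain ⟨Q, hQ, hXQ⟩ := hF.exists_not_subset htn hXc
  obtain ⟨hWQ, hQX, ht⟩ := hout Q hQ hXQ
  obtain ⟨hQp, hQs, hQc⟩ := mem_kPartitions.1 (hF.1 hQ)
  have hXB : ∀ B ∈ W, IsPartition (insert B X) := fun B hB =>
    isPartition_of_mem_heavy hF.1 ((hWmem B).1 hB).2
  have hXp : IsPartition X := by
    obtain ⟨B, hBW⟩ := hWne
    exact (hXB B hBW).mono (Finset.subset_insert _ _)
  have hM : IsPartition (X ∪ W) := by
    refine hXp.union (hQp.mono hWQ) ?_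
    refine (disjoint_support.2 fun B hB => ?_)
    have h := (hXB B hB).disjoint_erase (Finset.mem_insert_self B X)
    rw [Finset.erase_insert ((hWmem B).1 hB).1] at h
    exact h.symm
  have hMc : (X ∪ W).card = t + W.card := by
    rw [Finset.card_union_of_disjoint hWX, hXc]
  -- shape of the members that do not contain `X`
  have hshape : ∀ P ∈ F, ¬ X ⊆ P → W.card = k - t ∧
      ∃ C ∈ X, P = insert (C ∪ (support (X ∪ W))ᶜ) ((X ∪ W).erase C) := by
    intro P hP hXP
    obtain ⟨hWP, hPX, -⟩ := hout P hP hXP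
    obtain ⟨hPp, hPs, hPc⟩ := mem_kPartitions.1 (hF.1 hP)
    obtain ⟨C, hC, hCP⟩ := Finset.not_subset.1 hXP
    have hPXe : P ∩ X = X.erase C := by
      refine Finset.eq_of_subset_of_card_le (fun B hB => ?_) ?_
      · obtain ⟨hBP, hBX⟩ := Finset.mem_inter.1 hB
        exact Finset.mem_erase.2 ⟨fun h => hCP (h ▸ hBP), hBX⟩
      · rw [Finset.card_erase_of_mem hC, hXc, hPX]
    have hCW : C ∉ W := Finset.disjoint_left.1 hWX hC
    have hN : (X ∪ W).erase C ⊆ P := by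
      intro B hB
      obtain ⟨hBC, hB⟩ := Finset.mem_erase.1 hB
      rcases Finset.mem_union.1 hB with hB | hB
      · have : B ∈ P ∩ X := hPXe ▸ Finset.mem_erase.2 ⟨hBC, hB⟩
        exact (Finset.mem_inter.1 this).1
      · exact hWP hB
    have hCM : C ∈ X ∪ W := Finset.mem_union_left _ hC
    have hNc : ((X ∪ W).erase C).card = t - 1 + W.card := by
      rw [Finset.card_erase_of_mem hCM, hMc]; omega
    have hrest : support (P \ (X ∪ W).erase C) = C ∪ (support (X ∪ W))ᶜ := by
      rw [hPp.support_sdiff hN, hPs, hM.support_erase hCM]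
      ext x
      have := @subset_support _ _ _ hCM x
      simp only [Finset.mem_sdiff, Finset.mem_univ, Finset.mem_union, Finset.mem_compl]
      tauto
    have hlt : ((X ∪ W).erase C).card ≠ P.card := by
      intro h
      have h1 := Finset.eq_of_subset_of_card_le hN h.ge
      rw [h1, Finset.sdiff_self] at hrest
      obtain ⟨x, hx⟩ := hXp.1 C hC
      have : x ∈ support (∅ : Finset (Finset (Fin n))) := hrest ▸ Finset.mem_union_left _ hx
      simp [support] at this
    have hle := Finset.card_le_card hN
    have hWk : W.card = k - t := by omega
    have h1 : (P \ (X ∪ W).erase C).card = 1 := by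
      rw [Finset.card_sdiff_of_subset hN]; omega
    obtain ⟨D, hD⟩ := Finset.card_eq_one.1 h1
    have hDe : D = C ∪ (support (X ∪ W))ᶜ := by
      rw [← hrest, hD]; simp [support]
    refine ⟨hWk, C, hC, ?_⟩
    rw [← hDe, Finset.insert_eq, ← hD, Finset.sdiff_union_of_subset hN]
  obtain ⟨hWk, C, hC, hQe⟩ := hshape Q hQ hXQ
  refine ⟨X ∪ W, hM, Finset.subset_union_left, by omega, by omega, fun P hP => ?_⟩
  rw [familyH_eq]
  by_cases hXP : X ⊆ P
  · refine Finset.mem_union_left _ (Finset.mem_filter.2 ⟨mem_star.2 ⟨hF.1 hP, hXP⟩, ?_⟩)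
    rw [Finset.union_sdiff_cancel_left hWX]
    by_contra hne
    rw [Finset.not_nonempty_iff_eq_empty] at hne
    -- `P` and `Q` then share at most the `t - 1` blocks of `X \ {C}`
    obtain ⟨hPp, hPs, hPc⟩ := mem_kPartitions.1 (hF.1 hP)
    have h1 : P ∩ Q ⊆ X.erase C := by
      intro B hB
      obtain ⟨hBP, hBQ⟩ := Finset.mem_inter.1 hB
      rw [hQe] at hBQ
      rcases Finset.mem_insert.1 hBQ with h | h
      · obtain ⟨x, hx⟩ := hXp.1 C hC
        have hBC : B = C := hPp.eq_of_mem hBP (hXP hC) (h ▸ Finset.mem_union_left _ hx) hx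
        exact (hXQ fun A hA => by
          by_cases hAC : A = C
          · rw [hAC, ← hBC]; exact (Finset.mem_inter.1 hB).2
          · rw [hQe]
            exact Finset.mem_insert_of_mem
              (Finset.mem_erase.2 ⟨hAC, Finset.mem_union_left _ hA⟩)).elim
      · obtain ⟨hBC, hBM⟩ := Finset.mem_erase.1 h
        rcases Finset.mem_union.1 hBM with hBX | hBW
        · exact Finset.mem_erase.2 ⟨hBC, hBX⟩
        · have : B ∈ P ∩ W := Finset.mem_inter.2 ⟨hBP, hBW⟩
          simp [hne] at this
    have h2 := hF.2.1 P hP Q hQ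
    have h3 := Finset.card_le_card h1
    rw [Finset.card_erase_of_mem hC] at h3
    omega
  · obtain ⟨-, C, hC, hPe⟩ := hshape P hP hXP
    exact Finset.mem_union_right _ (Finset.mem_image.2 ⟨C, hC, hPe.symm⟩)

/-- The structural alternative for a non-trivial `t`-intersecting family. -/
lemma card_le_or_subset {k t : ℕ} {F : Finset (Finset (Finset (Fin n)))}
    (hF : IsNontrivialIntersecting n k t F) (ht : 1 ≤ t) (hk : t + 3 ≤ k) (hkn : k < n)
    (hr : ∀ i, t ≤ i → i + 2 ≤ k →
      ((t + 1) * (k - t + 1)) ^ 2 * extensionCount n k (i + 1) ≤ extensionCount n k i) :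
    F.card + extensionCount n k (t + 1) ≤ max (t + 2) (k - t) * extensionCount n k (t + 1) +
        (t + 1) * ((k - t + 1) * ((k - t + 1) * extensionCount n k (t + 2))) ∨
      (∃ Z : Finset (Finset (Fin n)), IsPartition Z ∧ Z.card = t + 2 ∧ k ≤ 2 * t + 2 ∧
        F ⊆ familyA n k t Z) ∨
      ∃ X M : Finset (Finset (Fin n)), IsPartition M ∧ X ⊆ M ∧ X.card = t ∧ M.card = k ∧
        2 * t + 2 ≤ k ∧ F ⊆ familyH n k X M := by
  by_cases hcov : ∃ T : Finset (Finset (Fin n)), T.card = t + 1 ∧ IsCover t F T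
  · obtain ⟨T, hTc, hT⟩ := hcov
    rcases lt_or_ge (heavy k t F).card (max (t + 2) (k - t)) with hlt | hge
    · left
      have h1 := card_le_sum_heavy hF (by omega) hk hT hTc
      have h2 := Nat.mul_le_mul_right (extensionCount n k (t + 1)) hlt
      rw [Nat.succ_mul] at h2
      omega
    · right
      have hcover : ∀ T ∈ heavy k t F, IsCover t F T := fun T hT =>
        isCover_of_mem_heavy hF.1 hF.2.1 hk hT
      rcases exists_core_or_hull (t := t) (H := heavy k t F) (fun T hT => (mem_heavy.1 hT).1)
        (fun T hT T' hT' => le_card_inter_of_mem_heavy hF.1 hk hT (hcover T' hT')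
          (by rw [(mem_heavy.1 hT').1]; omega)) (by omega) with ⟨X, hXc, hX⟩ | ⟨Z, hZc, hZ⟩
      · obtain ⟨M, h1, h2, h3, h4, h5⟩ := subset_familyH_of_core hF hk (by omega) hXc hX hge
        exact Or.inr ⟨X, M, h1, h2, hXc, h3, h4, h5⟩
      · obtain ⟨h1, h2, h3⟩ := subset_familyA_of_hull hF ht hk hZc hZ hge
        exact Or.inl ⟨Z, h1, hZc, h2, h3⟩
  · left
    push Not at hcov
    have h1 := card_le_of_no_cover hF hk hkn hr hcov
    have h2 := Nat.mul_le_mul_right (extensionCount n k (t + 1))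
      (le_max_left (t + 2) (k - t))
    have h3 : (t + 2) * extensionCount n k (t + 1) =
      (t + 1) * extensionCount n k (t + 1) + extensionCount n k (t + 1) := by ring
    omega

end KPartition

/-! ### The extremal families are non-trivial and `t`-intersecting -/

namespace KPartition

variable {n : ℕ}

lemma singletons_isPartition (n m : ℕ) : IsPartition (singletons n m) :=
  singleton_image_isPartition _

lemma card_of_mem_singletons {n m : ℕ} {B : Finset (Fin n)} (hB : B ∈ singletons n m) :
    B.card = 1 := by
  obtain ⟨i, -, rfl⟩ := Finset.mem_image.1 hB
  exact Finset.card_singleton i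

lemma card_filter_val_lt {n m : ℕ} (h : m ≤ n) :
    (Finset.univ.filter fun i : Fin n => i.val < m).card = m := by
  rw [Fin.card_filter_val_lt, min_eq_right h]

lemma card_singletons {n m : ℕ} (h : m ≤ n) : (singletons n m).card = m :=
  (card_singleton_image _).trans (card_filter_val_lt h)

lemma singletons_mono {n m m' : ℕ} (h : m ≤ m') : singletons n m ⊆ singletons n m' :=
  Finset.image_subset_image fun i hi => by
    simp only [Finset.mem_filter] at hi ⊢
    exact ⟨hi.1, hi.2.trans_le h⟩

/-- A set of blocks common to all `k`-partitions that contain the singletons `T` lies in `T`,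
because prescribing one more block lowers the number of extensions. -/
lemma subset_of_forall_mem_star {k : ℕ} {T X : Finset (Finset (Fin n))} (hT : IsPartition T)
    (h1 : ∀ B ∈ T, B.card = 1) (hk : T.card + 1 < k)
    (hlt : extensionCount n k (T.card + 1) < extensionCount n k T.card)
    (hX : ∀ P ∈ star (kPartitions n k) T, X ⊆ P) : X ⊆ T := by
  intro B hB
  by_contra hBT
  have h : star (kPartitions n k) T ⊆ star (kPartitions n k) (insert B T) := fun P hP =>
    mem_star.2 ⟨(mem_star.1 hP).1, Finset.insert_subset (hX P hP hB) (mem_star.1 hP).2⟩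
  have h2 := Finset.card_le_card h
  have h3 := card_star_le (Finset.Subset.refl (kPartitions n k))
    (Finset.card_insert_of_notMem hBT) hk
  rw [card_star_kPartitions_eq hT h1 (by omega)] at h2
  omega

lemma familyA_isNontrivialIntersecting {k t : ℕ} {Z : Finset (Finset (Fin n))}
    (hZ : IsPartition Z) (h1 : ∀ B ∈ Z, B.card = 1) (hZc : Z.card = t + 2) (ht : 1 ≤ t)
    (hk : t + 3 ≤ k) (hlt : extensionCount n k (t + 2) < extensionCount n k (t + 1)) :
    IsNontrivialIntersecting n k t (familyA n k t Z) := by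
  refine ⟨Finset.filter_subset _ _, fun P hP Q hQ => ?_, ?_⟩
  · have hP' := (Finset.mem_filter.1 hP).2
    have hQ' := (Finset.mem_filter.1 hQ).2
    have h2 := Finset.card_union_add_card_inter (P ∩ Z) (Q ∩ Z)
    have h3 : (P ∩ Z ∪ Q ∩ Z).card ≤ Z.card := Finset.card_le_card
      (Finset.union_subset Finset.inter_subset_right Finset.inter_subset_right)
    have h4 : (P ∩ Z ∩ (Q ∩ Z)).card ≤ (P ∩ Q).card := Finset.card_le_card
      (Finset.inter_subset_inter Finset.inter_subset_left Finset.inter_subset_left)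
    omega
  · rintro ⟨X, -, hXc, hX⟩
    have hsub : ∀ B ∈ Z, X ⊆ Z.erase B := by
      intro B hB
      have hc : (Z.erase B).card = t + 1 := by
        rw [Finset.card_erase_of_mem hB, hZc]; rfl
      refine subset_of_forall_mem_star (k := k) (hZ.mono (Finset.erase_subset _ _))
        (fun C hC => h1 C (Finset.mem_of_mem_erase hC)) (by omega) (by rwa [hc]) fun P hP => ?_
      obtain ⟨hP, hBP⟩ := mem_star.1 hP
      refine hX P (Finset.mem_filter.2 ⟨hP, ?_⟩)
      rw [← hc]
      exact Finset.card_le_card (Finset.subset_inter hBP (Finset.erase_subset _ _))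
    obtain ⟨B, hB⟩ := Finset.card_pos.1 (by omega : 0 < X.card)
    obtain ⟨C, hC⟩ := Finset.card_pos.1 (by omega : 0 < Z.card)
    have hBZ := Finset.mem_of_mem_erase (hsub C hC hB)
    exact Finset.notMem_erase B Z (hsub B hBZ hB)

lemma enlarge_mem_kPartitions {k : ℕ} {M : Finset (Finset (Fin n))} (hM : IsPartition M)
    (hMc : M.card = k) {C : Finset (Fin n)} (hC : C ∈ M) :
    insert (C ∪ (support M)ᶜ) (M.erase C) ∈ kPartitions n k := by
  have hne : (C ∪ (support M)ᶜ).Nonempty := (hM.1 C hC).mono Finset.subset_union_left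
  have hd : Disjoint (C ∪ (support M)ᶜ) (support (M.erase C)) := by
    refine Finset.disjoint_union_left.2 ⟨hM.disjoint_erase hC, ?_⟩
    exact (disjoint_compl_right.mono_left (support_mono (Finset.erase_subset _ _))).symm
  refine mem_kPartitions.2 ⟨(hM.mono (Finset.erase_subset _ _)).insert hne hd, ?_, ?_⟩
  · rw [support_insert, hM.support_erase hC]
    ext x
    simp only [Finset.mem_sdiff, Finset.mem_univ, Finset.mem_union, Finset.mem_compl]
    tauto
  · have := Finset.card_pos.2 ⟨C, hC⟩
    rw [Finset.card_insert_of_notMem (notMem_of_disjoint_support hne hd),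
      Finset.card_erase_of_mem hC]
    omega

lemma notMem_enlarge {M : Finset (Finset (Fin n))} (hs : support M ≠ Finset.univ)
    {C : Finset (Fin n)} (hC : C ∈ M) : C ∉ insert (C ∪ (support M)ᶜ) (M.erase C) := by
  intro h
  rcases Finset.mem_insert.1 h with h | h
  · refine hs (Finset.eq_univ_of_forall fun x => ?_)
    by_contra hx
    have hxC : x ∈ C := by
      rw [h]; exact Finset.mem_union_right _ (Finset.mem_compl.2 hx)
    exact hx (subset_support hC hxC)
  · exact Finset.notMem_erase C M h

lemma support_ne_univ {k : ℕ} {M : Finset (Finset (Fin n))} (hM : IsPartition M)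
    (h1 : ∀ B ∈ M, B.card = 1) (hMc : M.card = k) (hkn : k < n) : support M ≠ Finset.univ := by
  intro h
  have h2 := hM.card_support
  rw [Finset.sum_congr rfl h1, ← Finset.card_eq_sum_ones, h, Finset.card_univ,
    Fintype.card_fin] at h2
  omega

lemma familyH_isNontrivialIntersecting {k t : ℕ} {X M : Finset (Finset (Fin n))}
    (hM : IsPartition M) (h1 : ∀ B ∈ M, B.card = 1) (hXM : X ⊆ M) (hXc : X.card = t)
    (hMc : M.card = k) (ht : 1 ≤ t) (hk : t + 3 ≤ k) (hkn : k < n)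
    (hlt : extensionCount n k (t + 2) < extensionCount n k (t + 1)) :
    IsNontrivialIntersecting n k t (familyH n k X M) := by
  have hs := support_ne_univ hM h1 hMc hkn
  have hmain : ∀ P ∈ familyHMain n k X M, ∀ C ∈ X,
      t ≤ (P ∩ insert (C ∪ (support M)ᶜ) (M.erase C)).card := by
    intro P hP C hC
    obtain ⟨hP, B, hB⟩ := Finset.mem_filter.1 hP
    obtain ⟨-, hXP⟩ := mem_star.1 hP
    obtain ⟨hBP, hB⟩ := Finset.mem_inter.1 hB
    obtain ⟨hBM, hBX⟩ := Finset.mem_sdiff.1 hB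
    have hBC : B ≠ C := fun h => hBX (h ▸ hC)
    have hsub : insert B (X.erase C) ⊆ P ∩ insert (C ∪ (support M)ᶜ) (M.erase C) := by
      refine Finset.insert_subset (Finset.mem_inter.2 ⟨hBP, Finset.mem_insert_of_mem
        (Finset.mem_erase.2 ⟨hBC, hBM⟩)⟩) fun D hD => ?_
      obtain ⟨hDC, hD⟩ := Finset.mem_erase.1 hD
      exact Finset.mem_inter.2 ⟨hXP hD, Finset.mem_insert_of_mem
        (Finset.mem_erase.2 ⟨hDC, hXM hD⟩)⟩
    have := Finset.card_le_card hsub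
    rw [Finset.card_insert_of_notMem (fun h => hBX (Finset.mem_of_mem_erase h)),
      Finset.card_erase_of_mem hC] at this
    omega
  rw [familyH_eq]
  refine ⟨?_, ?_, ?_⟩
  · refine Finset.union_subset ((Finset.filter_subset _ _).trans (Finset.filter_subset _ _)) ?_
    intro P hP
    obtain ⟨C, hC, rfl⟩ := Finset.mem_image.1 hP
    exact enlarge_mem_kPartitions hM hMc (hXM hC)
  · intro P hP Q hQ
    rcases Finset.mem_union.1 hP with hP | hP <;> rcases Finset.mem_union.1 hQ with hQ | hQ
    · rw [← hXc]
      exact Finset.card_le_card (Finset.subset_inter (mem_star.1 (Finset.mem_filter.1 hP).1).2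
        (mem_star.1 (Finset.mem_filter.1 hQ).1).2)
    · obtain ⟨C, hC, rfl⟩ := Finset.mem_image.1 hQ
      exact hmain P hP C hC
    · obtain ⟨C, hC, rfl⟩ := Finset.mem_image.1 hP
      rw [Finset.inter_comm]
      exact hmain Q hQ C hC
    · obtain ⟨C, hC, rfl⟩ := Finset.mem_image.1 hP
      obtain ⟨D, hD, rfl⟩ := Finset.mem_image.1 hQ
      have hsub : (M.erase C).erase D ⊆ insert (C ∪ (support M)ᶜ) (M.erase C) ∩
          insert (D ∪ (support M)ᶜ) (M.erase D) :=
        Finset.subset_inter ((Finset.erase_subset _ _).trans (Finset.subset_insert _ _))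
          ((Finset.erase_subset_erase _ (Finset.erase_subset _ _)).trans
            (Finset.subset_insert _ _))
      have h2 := Finset.card_le_card hsub
      have h3 := Finset.pred_card_le_card_erase (s := M) (a := C)
      have h4 := Finset.pred_card_le_card_erase (s := M.erase C) (a := D)
      omega
  · rintro ⟨Y, -, hYc, hY⟩
    have hsub : ∀ B ∈ M \ X, Y ⊆ insert B X := by
      intro B hB
      obtain ⟨hBM, hBX⟩ := Finset.mem_sdiff.1 hB
      have hs : insert B X ⊆ M := Finset.insert_subset hBM hXM
      have hc : (insert B X).card = t + 1 := by rw [Finset.card_insert_of_notMem hBX, hXc]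
      refine subset_of_forall_mem_star (k := k) (hM.mono hs) (fun C hC => h1 C (hs hC))
        (by omega) (by rwa [hc]) fun P hP => hY P (Finset.mem_union_left _ ?_)
      obtain ⟨hP, hBP⟩ := mem_star.1 hP
      exact Finset.mem_filter.2 ⟨mem_star.2 ⟨hP, (Finset.subset_insert _ _).trans hBP⟩,
        B, Finset.mem_inter.2 ⟨hBP (Finset.mem_insert_self _ _), hB⟩⟩
    have hcard : (M \ X).card = k - t := by rw [Finset.card_sdiff_of_subset hXM, hMc, hXc]
    obtain ⟨B, hB, B', hB', hne⟩ := Finset.one_lt_card.1 (by omega : 1 < (M \ X).card)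
    have hYX : Y ⊆ X := by
      intro C hC
      rcases Finset.mem_insert.1 (hsub B hB hC) with h | h
      · rcases Finset.mem_insert.1 (hsub B' hB' hC) with h' | h'
        · exact (hne (h.symm.trans h')).elim
        · exact h'
      · exact h
    have hYe : Y = X := Finset.eq_of_subset_of_card_le hYX (by omega)
    subst hYe
    obtain ⟨C, hC⟩ := Finset.card_pos.1 (by omega : 0 < Y.card)
    have := hY _ (Finset.mem_union_right _ (Finset.mem_image_of_mem _ hC)) hC
    exact notMem_enlarge hs (hXM hC) this

/-! ### Relabelling the ground set -/

/-- The image of a set of blocks under a permutation of the ground set. -/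
def relabel (σ : Equiv.Perm (Fin n)) (P : Finset (Finset (Fin n))) : Finset (Finset (Fin n)) :=
  P.image fun B => B.image σ

lemma image_injective (σ : Equiv.Perm (Fin n)) :
    Function.Injective fun B : Finset (Fin n) => B.image σ :=
  Finset.image_injective σ.injective

lemma relabel_injective (σ : Equiv.Perm (Fin n)) : Function.Injective (relabel σ) :=
  Finset.image_injective (image_injective σ)

lemma image_inv_image (σ : Equiv.Perm (Fin n)) (B : Finset (Fin n)) :
    (B.image σ).image (σ⁻¹ : Equiv.Perm (Fin n)) = B := by
  ext x
  simp

lemma relabel_inv_relabel (σ : Equiv.Perm (Fin n)) (P : Finset (Finset (Fin n))) :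
    relabel σ⁻¹ (relabel σ P) = P := by
  have h : (fun B : Finset (Fin n) => B.image (σ⁻¹ : Equiv.Perm (Fin n))) ∘
      (fun B => B.image σ) = id := funext fun B => image_inv_image σ B
  rw [relabel, relabel, Finset.image_image, h, Finset.image_id]

lemma support_relabel (σ : Equiv.Perm (Fin n)) (P : Finset (Finset (Fin n))) :
    support (relabel σ P) = (support P).image σ := by
  ext x
  simp only [mem_support, relabel, Finset.mem_image]
  constructor
  · rintro ⟨_, ⟨B, hB, rfl⟩, hx⟩
    obtain ⟨y, hy, rfl⟩ := Finset.mem_image.1 hx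
    exact ⟨y, ⟨B, hB, hy⟩, rfl⟩
  · rintro ⟨y, ⟨B, hB, hy⟩, rfl⟩
    exact ⟨_, ⟨B, hB, rfl⟩, Finset.mem_image_of_mem _ hy⟩

lemma card_relabel (σ : Equiv.Perm (Fin n)) (P : Finset (Finset (Fin n))) :
    (relabel σ P).card = P.card :=
  Finset.card_image_of_injective _ (image_injective σ)

lemma relabel_inter (σ : Equiv.Perm (Fin n)) (P Q : Finset (Finset (Fin n))) :
    relabel σ (P ∩ Q) = relabel σ P ∩ relabel σ Q :=
  Finset.image_inter _ _ (image_injective σ)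

lemma relabel_sdiff (σ : Equiv.Perm (Fin n)) (P Q : Finset (Finset (Fin n))) :
    relabel σ (P \ Q) = relabel σ P \ relabel σ Q :=
  Finset.image_sdiff _ _ (image_injective σ)

lemma relabel_mem_kPartitions {k : ℕ} (σ : Equiv.Perm (Fin n)) {P : Finset (Finset (Fin n))}
    (hP : P ∈ kPartitions n k) : relabel σ P ∈ kPartitions n k := by
  obtain ⟨hP, hs, hc⟩ := mem_kPartitions.1 hP
  refine mem_kPartitions.2 ⟨⟨?_, ?_⟩, ?_, ?_⟩
  · intro B hB
    obtain ⟨C, hC, rfl⟩ := Finset.mem_image.1 hB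
    exact (hP.1 C hC).image _
  · intro B hB B' hB' hne
    obtain ⟨C, hC, rfl⟩ := Finset.mem_image.1 hB
    obtain ⟨C', hC', rfl⟩ := Finset.mem_image.1 hB'
    exact (Finset.disjoint_image σ.injective).2 (hP.2 C hC C' hC' fun h => hne (h ▸ rfl))
  · rw [support_relabel, hs, Finset.image_univ_equiv]
  · rw [card_relabel, hc]

lemma relabel_mem_familyA {k t : ℕ} (σ : Equiv.Perm (Fin n)) {Z P : Finset (Finset (Fin n))}
    (hP : P ∈ familyA n k t Z) : relabel σ P ∈ familyA n k t (relabel σ Z) := by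
  obtain ⟨hP, hZ⟩ := Finset.mem_filter.1 hP
  refine Finset.mem_filter.2 ⟨relabel_mem_kPartitions σ hP, ?_⟩
  rwa [← relabel_inter, card_relabel]

lemma relabel_mem_familyH {k : ℕ} (σ : Equiv.Perm (Fin n)) {X M P : Finset (Finset (Fin n))}
    (hP : P ∈ familyH n k X M) : relabel σ P ∈ familyH n k (relabel σ X) (relabel σ M) := by
  rw [familyH_eq] at hP ⊢
  rcases Finset.mem_union.1 hP with hP | hP
  · refine Finset.mem_union_left _ ?_
    obtain ⟨hP, hM⟩ := Finset.mem_filter.1 hP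
    obtain ⟨hP, hX⟩ := mem_star.1 hP
    refine Finset.mem_filter.2 ⟨mem_star.2 ⟨relabel_mem_kPartitions σ hP,
      Finset.image_subset_image hX⟩, ?_⟩
    rw [← relabel_sdiff, ← relabel_inter]
    exact hM.image _
  · refine Finset.mem_union_right _ ?_
    obtain ⟨C, hC, rfl⟩ := Finset.mem_image.1 hP
    refine Finset.mem_image.2 ⟨C.image σ, Finset.mem_image_of_mem _ hC, ?_⟩
    simp only [relabel, Finset.image_insert, Finset.image_union,
      Finset.image_erase (image_injective σ)]
    rw [← relabel, support_relabel, Finset.compl_eq_univ_sdiff, Finset.compl_eq_univ_sdiff,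
      Finset.image_sdiff _ _ σ.injective, Finset.image_univ_equiv]

lemma relabel_relabel_inv (σ : Equiv.Perm (Fin n)) (P : Finset (Finset (Fin n))) :
    relabel σ (relabel σ⁻¹ P) = P := by
  have := relabel_inv_relabel σ⁻¹ P
  rwa [inv_inv] at this

lemma isomorphic_familyA (k t : ℕ) (σ : Equiv.Perm (Fin n)) (Z : Finset (Finset (Fin n))) :
    Isomorphic (familyA n k t Z) (familyA n k t (relabel σ Z)) := by
  refine ⟨σ, Finset.Subset.antisymm (Finset.image_subset_iff.2 fun P hP =>
    relabel_mem_familyA σ hP) fun Q hQ => Finset.mem_image.2 ⟨relabel σ⁻¹ Q, ?_, ?_⟩⟩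
  · have := relabel_mem_familyA σ⁻¹ hQ
    rwa [relabel_inv_relabel] at this
  · exact relabel_relabel_inv σ Q

lemma isomorphic_familyH (k : ℕ) (σ : Equiv.Perm (Fin n)) (X M : Finset (Finset (Fin n))) :
    Isomorphic (familyH n k X M) (familyH n k (relabel σ X) (relabel σ M)) := by
  refine ⟨σ, Finset.Subset.antisymm (Finset.image_subset_iff.2 fun P hP =>
    relabel_mem_familyH σ hP) fun Q hQ => Finset.mem_image.2 ⟨relabel σ⁻¹ Q, ?_, ?_⟩⟩
  · have := relabel_mem_familyH σ⁻¹ hQ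
    rwa [relabel_inv_relabel, relabel_inv_relabel] at this
  · exact relabel_relabel_inv σ Q

lemma Isomorphic.card_eq {F G : Finset (Finset (Finset (Fin n)))} (h : Isomorphic F G) :
    F.card = G.card := by
  obtain ⟨σ, rfl⟩ := h
  exact (Finset.card_image_of_injective _ (relabel_injective σ)).symm

/-- Some permutation carries nested subsets onto initial segments of the ground set. -/
lemma exists_perm_image {U V : Finset (Fin n)} (hUV : U ⊆ V) :
    ∃ σ : Equiv.Perm (Fin n), U.image σ = Finset.univ.filter (fun i => i.val < U.card) ∧
      V.image σ = Finset.univ.filter (fun i => i.val < V.card) := by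
  have hVn : V.card ≤ n := by simpa using Finset.card_le_univ V
  have hle := Finset.card_le_card hUV
  set A := Finset.univ.filter (fun i : Fin n => i.val < U.card) with hA
  set B := Finset.univ.filter (fun i : Fin n => i.val < V.card) with hB
  have hAc : A.card = U.card := card_filter_val_lt (hle.trans hVn)
  have hBc : B.card = V.card := card_filter_val_lt hVn
  have hAB : A ⊆ B := fun i hi => by
    simp only [hA, hB, Finset.mem_filter] at hi ⊢
    exact ⟨hi.1, hi.2.trans_le hle⟩
  -- colour each element by its membership in the two sets and match the colour classes
  let f : Fin n → Prop × Prop := fun i => (i ∈ U, i ∈ V)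
  let g : Fin n → Prop × Prop := fun i => (i ∈ A, i ∈ B)
  have key : ∀ c, Nonempty ({a // f a = c} ≃ {b // g b = c}) := by
    classical
    intro c
    refine ⟨Fintype.equivOfCardEq ?_⟩
    rw [Fintype.card_subtype, Fintype.card_subtype]
    obtain ⟨p, q⟩ := c
    simp only [f, g, Prod.mk.injEq, eq_iff_iff]
    by_cases hp : p <;> by_cases hq : q <;> simp only [hp, hq, iff_true, iff_false]
    · have h1 : (Finset.univ.filter fun a => a ∈ U ∧ a ∈ V) = U := by
        ext x; simpa using @hUV x
      have h2 : (Finset.univ.filter fun a => a ∈ A ∧ a ∈ B) = A := by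
        ext x; simpa using @hAB x
      rw [h1, h2, hAc]
    · have h1 : (Finset.univ.filter fun a => a ∈ U ∧ a ∉ V) = U \ V := by ext x; simp
      have h2 : (Finset.univ.filter fun a => a ∈ A ∧ a ∉ B) = A \ B := by ext x; simp
      rw [h1, h2, Finset.sdiff_eq_empty_iff_subset.2 hUV, Finset.sdiff_eq_empty_iff_subset.2 hAB]
    · have h1 : (Finset.univ.filter fun a => a ∉ U ∧ a ∈ V) = V \ U := by
        ext x; simp [and_comm]
      have h2 : (Finset.univ.filter fun a => a ∉ A ∧ a ∈ B) = B \ A := by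
        ext x; simp [and_comm]
      rw [h1, h2, Finset.card_sdiff_of_subset hUV, Finset.card_sdiff_of_subset hAB, hAc, hBc]
    · have h1 : (Finset.univ.filter fun a => a ∉ U ∧ a ∉ V) = Vᶜ := by
        ext x; simpa using fun h h' => h (hUV h')
      have h2 : (Finset.univ.filter fun a => a ∉ A ∧ a ∉ B) = Bᶜ := by
        ext x; simpa using fun h h' => h (hAB h')
      rw [h1, h2, Finset.card_compl, Finset.card_compl, hBc]
  let e := fun c => (key c).some
  have hσ := Equiv.ofFiberEquiv_map e
  refine ⟨Equiv.ofFiberEquiv e, Finset.eq_of_subset_of_card_le ?_ ?_,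
    Finset.eq_of_subset_of_card_le ?_ ?_⟩
  · intro y hy
    obtain ⟨x, hx, rfl⟩ := Finset.mem_image.1 hy
    exact (congrArg Prod.fst (hσ x)).mpr hx
  · rw [hAc, Finset.card_image_of_injective _ (Equiv.injective _)]
  · intro y hy
    obtain ⟨x, hx, rfl⟩ := Finset.mem_image.1 hy
    exact (congrArg Prod.snd (hσ x)).mpr hx
  · rw [hBc, Finset.card_image_of_injective _ (Equiv.injective _)]

lemma relabel_eq_singletons {Z : Finset (Finset (Fin n))} (h1 : ∀ B ∈ Z, B.card = 1)
    (hZ : IsPartition Z) {m : ℕ} (hm : Z.card = m) {σ : Equiv.Perm (Fin n)}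
    (hσ : (support Z).image σ = Finset.univ.filter fun i => i.val < (support Z).card) :
    relabel σ Z = singletons n m := by
  have hc : (support Z).card = m := by
    rw [hZ.card_support, Finset.sum_congr rfl h1, ← Finset.card_eq_sum_ones, hm]
  have hmn : m ≤ n := by rw [← hc]; simpa using Finset.card_le_univ (support Z)
  rw [hc] at hσ
  refine Finset.eq_of_subset_of_card_le (fun B hB => ?_) ?_
  · obtain ⟨C, hC, rfl⟩ := Finset.mem_image.1 hB
    obtain ⟨x, rfl⟩ := Finset.card_eq_one.1 (h1 C hC)
    refine Finset.mem_image.2 ⟨σ x, ?_, by simp⟩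
    rw [← hσ]
    exact Finset.mem_image_of_mem _ (subset_support hC (Finset.mem_singleton_self x))
  · rw [card_singletons hmn, card_relabel, hm]

lemma familyA_isomorphic_frankl (k : ℕ) {t : ℕ} {Z : Finset (Finset (Fin n))}
    (hZ : IsPartition Z) (h1 : ∀ B ∈ Z, B.card = 1) (hZc : Z.card = t + 2) :
    Isomorphic (familyA n k t Z) (frankl n k t) := by
  obtain ⟨σ, hσ, -⟩ := exists_perm_image (Finset.Subset.refl (support Z))
  have := isomorphic_familyA k t σ Z
  rwa [relabel_eq_singletons h1 hZ hZc hσ] at this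

lemma familyH_isomorphic_hiltonMilner {k t : ℕ} {X M : Finset (Finset (Fin n))}
    (hM : IsPartition M) (h1 : ∀ B ∈ M, B.card = 1) (hXM : X ⊆ M) (hXc : X.card = t)
    (hMc : M.card = k) : Isomorphic (familyH n k X M) (hiltonMilner n k t) := by
  obtain ⟨σ, hσ, hσ'⟩ := exists_perm_image (support_mono hXM)
  have := isomorphic_familyH k σ X M
  rwa [relabel_eq_singletons h1 hM hMc hσ',
    relabel_eq_singletons (fun B hB => h1 B (hXM hB)) (hM.mono hXM) hXc hσ] at this

end KPartition

/-! ### Comparison with the extremal families -/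

namespace KPartition

variable {n : ℕ}

lemma card_frankl_add {k t : ℕ} (hk : t + 3 ≤ k) (hkn : k < n) :
    (frankl n k t).card + (t + 1) * extensionCount n k (t + 2) =
      (t + 2) * extensionCount n k (t + 1) :=
  card_familyA (singletons_isPartition _ _) (fun _ hB => card_of_mem_singletons hB)
    (card_singletons (by omega)) (by omega)

lemma card_familyHMain_le_card_familyH (k : ℕ) (X M : Finset (Finset (Fin n))) :
    (familyHMain n k X M).card ≤ (familyH n k X M).card := by
  rw [familyH_eq]
  exact Finset.card_le_card Finset.subset_union_left

lemma le_card_hiltonMilner {k t : ℕ} (hk : t + 3 ≤ k) (hkn : k < n) :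
    (k - t) * extensionCount n k (t + 1) ≤ (hiltonMilner n k t).card +
      (k - t).choose 2 * extensionCount n k (t + 2) := by
  have h := le_card_familyHMain (k := k) (singletons_isPartition n k)
    (fun _ hB => card_of_mem_singletons hB) (singletons_mono (n := n) (by omega : t ≤ k))
    (card_singletons hkn.le)
  rw [card_singletons (by omega)] at h
  exact h.trans (Nat.add_le_add_right (card_familyHMain_le_card_familyH _ _ _) _)

lemma two_mul_choose_two_le (d : ℕ) : 2 * d.choose 2 ≤ d * d := by
  have h := Nat.div_mul_le_self (d * (d - 1)) 2
  rw [← Nat.choose_two_right] at h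
  calc 2 * d.choose 2 ≤ d * (d - 1) := by omega
    _ ≤ d * d := Nat.mul_le_mul_left _ (Nat.sub_le _ _)

/-- The error terms are dominated by a single `extensionCount n k (t + 1)`. -/
lemma error_terms_le {k t : ℕ} (ht : 1 ≤ t) (hk : t + 3 ≤ k) (hkn : k < n)
    (hr : ∀ i, t ≤ i → i + 2 ≤ k →
      ((t + 1) * (k - t + 1)) ^ 2 * extensionCount n k (i + 1) ≤ extensionCount n k i) :
    2 * ((t + 1) * ((k - t + 1) * ((k - t + 1) * extensionCount n k (t + 2)))) ≤
        extensionCount n k (t + 1) ∧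
      16 * extensionCount n k (t + 2) ≤
        (k - t + 1) * ((k - t + 1) * extensionCount n k (t + 2)) ∧
      2 * ((k - t).choose 2 * extensionCount n k (t + 2)) ≤
        (k - t + 1) * ((k - t + 1) * extensionCount n k (t + 2)) ∧
      1 ≤ extensionCount n k (t + 2) := by
  have h := hr (t + 1) (by omega) (by omega)
  have hpos : 0 < extensionCount n k (t + 2) := extensionCount_pos (by omega) hkn.le
  have hC := two_mul_choose_two_le (k - t)
  obtain ⟨d, rfl⟩ : ∃ d, k = t + d := ⟨k - t, by omega⟩
  have hd : t + d - t = d := by omega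
  rw [hd] at h hC ⊢
  set e := extensionCount n (t + d) (t + 2) with he
  refine ⟨le_trans ?_ h, ?_, ?_, hpos⟩
  · calc 2 * ((t + 1) * ((d + 1) * ((d + 1) * e))) ≤
          (t + 1) * ((t + 1) * ((d + 1) * ((d + 1) * e))) := Nat.mul_le_mul_right _ (by omega)
      _ = _ := by rw [he]; ring
  · rw [← mul_assoc]
    exact Nat.mul_le_mul_right _ (by nlinarith)
  · rw [← mul_assoc, ← mul_assoc]
    exact Nat.mul_le_mul_right _ (by nlinarith)

lemma card_lt_max_of_le {k t : ℕ} {F : Finset (Finset (Finset (Fin n)))}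
    (ht : 1 ≤ t) (hk : t + 3 ≤ k) (hkn : k < n)
    (hr : ∀ i, t ≤ i → i + 2 ≤ k →
      ((t + 1) * (k - t + 1)) ^ 2 * extensionCount n k (i + 1) ≤ extensionCount n k i)
    (hF : F.card + extensionCount n k (t + 1) ≤
      max (t + 2) (k - t) * extensionCount n k (t + 1) +
        (t + 1) * ((k - t + 1) * ((k - t + 1) * extensionCount n k (t + 2)))) :
    F.card < max (frankl n k t).card (hiltonMilner n k t).card := by
  obtain ⟨h1, h2, h3, h4⟩ := error_terms_le ht hk hkn hr
  have hA := card_frankl_add hk hkn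
  have hH := le_card_hiltonMilner hk hkn
  rw [lt_max_iff]
  rcases max_choice (t + 2) (k - t) with hm | hm <;> rw [hm] at hF
  · left
    have := Nat.mul_le_mul_left (t + 1) h2
    have : (t + 1) * (16 * extensionCount n k (t + 2)) =
      16 * ((t + 1) * extensionCount n k (t + 2)) := by ring
    have := Nat.mul_pos (by omega : 0 < t + 1) h4
    omega
  · right
    have := Nat.le_mul_of_pos_left
      ((k - t + 1) * ((k - t + 1) * extensionCount n k (t + 2))) (by omega : 0 < t + 1)
    omega

/-- A `familyA` built on a partition with a non-singleton block is smaller: all but one of the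
`(t + 1)`-subsets contain that block. -/
lemma card_familyA_lt {k t : ℕ} {Z : Finset (Finset (Fin n))} (ht : 1 ≤ t) (hk : t + 3 ≤ k)
    (hkn : k < n)
    (hr : ∀ i, t ≤ i → i + 2 ≤ k →
      ((t + 1) * (k - t + 1)) ^ 2 * extensionCount n k (i + 1) ≤ extensionCount n k i)
    (hZc : Z.card = t + 2) {B : Finset (Fin n)} (hB : B ∈ Z) (hB2 : 2 ≤ B.card) :
    (familyA n k t Z).card < (frankl n k t).card := by
  obtain ⟨h1, h2, h3, h4⟩ := error_terms_le ht hk hkn hr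
  have hA := card_frankl_add hk hkn
  set e := extensionCount n k (t + 1) with he
  have hT : ∀ T ∈ Z.powersetCard (t + 1), 2 * (star (kPartitions n k) T).card ≤
      e + if B ∉ T then e else 0 := by
    intro T hT
    obtain ⟨hTZ, hTc⟩ := Finset.mem_powersetCard.1 hT
    by_cases hBT : B ∈ T
    · rw [if_neg (not_not.2 hBT), add_zero]
      have h5 := mul_card_star_kPartitions_le (k := k) (by omega) hBT hB2
      rw [hTc] at h5
      exact (Nat.mul_le_mul_right _ (by omega)).trans h5
    · rw [if_pos hBT]
      have h5 := card_star_le (Finset.Subset.refl (kPartitions n k)) hTc (by omega)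
      omega
  have hone : ((Z.powersetCard (t + 1)).filter (B ∉ ·)).card ≤ 1 := by
    refine Finset.card_le_one_iff_subset_singleton.2 ⟨Z.erase B, fun T hT => ?_⟩
    obtain ⟨hT, hBT⟩ := Finset.mem_filter.1 hT
    obtain ⟨hTZ, hTc⟩ := Finset.mem_powersetCard.1 hT
    refine Finset.mem_singleton.2 (Finset.eq_of_subset_of_card_le
      (Finset.subset_erase.2 ⟨hTZ, hBT⟩) ?_)
    rw [Finset.card_erase_of_mem hB]
    omega
  have hsum : 2 * (familyA n k t Z).card ≤ (t + 2) * e + e :=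
    calc 2 * (familyA n k t Z).card
        ≤ ∑ T ∈ Z.powersetCard (t + 1), 2 * (star (kPartitions n k) T).card := by
          rw [← Finset.mul_sum]
          exact Nat.mul_le_mul_left _ (card_familyA_le k t Z)
      _ ≤ ∑ T ∈ Z.powersetCard (t + 1), (e + if B ∉ T then e else 0) := Finset.sum_le_sum hT
      _ = (t + 2) * e + ((Z.powersetCard (t + 1)).filter (B ∉ ·)).card * e := by
          rw [Finset.sum_add_distrib, Finset.sum_const, Finset.card_powersetCard, hZc,
            Nat.choose_succ_self_right, ← Finset.sum_filter, Finset.sum_const, smul_eq_mul,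
            smul_eq_mul]
      _ ≤ (t + 2) * e + 1 * e := Nat.add_le_add_left (Nat.mul_le_mul_right _ hone) _
      _ = (t + 2) * e + e := by rw [one_mul]
  have h6 := Nat.mul_le_mul_left (t + 1) h2
  have h7 : (t + 1) * (16 * extensionCount n k (t + 2)) =
    16 * ((t + 1) * extensionCount n k (t + 2)) := by ring
  have h8 : 3 * e ≤ (t + 2) * e := Nat.mul_le_mul_right _ (by omega)
  have := Nat.mul_pos (by omega : 0 < t + 1) h4
  omega

/-- A `familyH` built on a partition with a non-singleton block is smaller: some block of `M \ X`
completes `X` to a set of blocks with a small star. -/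
lemma card_familyH_lt {k t : ℕ} {X M : Finset (Finset (Fin n))} (ht : 1 ≤ t) (hk : t + 3 ≤ k)
    (hkn : k < n)
    (hr : ∀ i, t ≤ i → i + 2 ≤ k →
      ((t + 1) * (k - t + 1)) ^ 2 * extensionCount n k (i + 1) ≤ extensionCount n k i)
    (hXM : X ⊆ M) (hXc : X.card = t) (hMc : M.card = k) {B : Finset (Fin n)} (hB : B ∈ M)
    (hB2 : 2 ≤ B.card) : (familyH n k X M).card < (hiltonMilner n k t).card := by
  obtain ⟨h1, h2, h3, h4⟩ := error_terms_le ht hk hkn hr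
  have hH := le_card_hiltonMilner hk hkn
  have hMX : (M \ X).card = k - t := by rw [Finset.card_sdiff_of_subset hXM, hMc, hXc]
  set e := extensionCount n k (t + 1) with he
  obtain ⟨C, hC, hBC⟩ : ∃ C ∈ M \ X, B ∈ insert C X := by
    by_cases hBX : B ∈ X
    · obtain ⟨C, hC⟩ := Finset.card_pos.1 (by omega : 0 < (M \ X).card)
      exact ⟨C, hC, Finset.mem_insert_of_mem hBX⟩
    · exact ⟨B, Finset.mem_sdiff.2 ⟨hB, hBX⟩, Finset.mem_insert_self _ _⟩
  have hcard : ∀ D ∈ M \ X, (insert D X).card = t + 1 := fun D hD => by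
    rw [Finset.card_insert_of_notMem (Finset.mem_sdiff.1 hD).2, hXc]
  have hCs : 2 * (star (kPartitions n k) (insert C X)).card ≤ e := by
    have h5 := mul_card_star_kPartitions_le (k := k) (by rw [hcard C hC]; omega) hBC hB2
    rw [hcard C hC] at h5
    exact (Nat.mul_le_mul_right _ (by omega)).trans h5
  have hsum : (familyHMain n k X M).card ≤
      (star (kPartitions n k) (insert C X)).card + (k - t - 1) * e := by
    refine (card_familyHMain_le k X M).trans ?_
    rw [← Finset.add_sum_erase _ _ hC]
    refine Nat.add_le_add_left ?_ _
    have h6 := Finset.sum_le_card_nsmul ((M \ X).erase C)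
      (fun D => (star (kPartitions n k) (insert D X)).card) e fun D hD =>
        card_star_le (Finset.Subset.refl _) (hcard D (Finset.mem_of_mem_erase hD)) (by omega)
    rwa [Finset.card_erase_of_mem hC, hMX, smul_eq_mul] at h6
  have h5 := card_familyH_le k X M
  have h7 : (k - t) * e = (k - t - 1) * e + e := by
    rw [← Nat.succ_mul]; congr 1; omega
  have h8 : (t + 1) * ((k - t + 1) * ((k - t + 1) * extensionCount n k (t + 2))) =
      t * ((k - t + 1) * ((k - t + 1) * extensionCount n k (t + 2))) +
        (k - t + 1) * ((k - t + 1) * extensionCount n k (t + 2)) := by ring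
  have h9 : t * 16 ≤ t * ((k - t + 1) * ((k - t + 1) * extensionCount n k (t + 2))) :=
    Nat.mul_le_mul_left _ (by omega)
  omega

/-- A non-trivial `t`-intersecting family is smaller than the bound or isomorphic to one of the
two extremal families. -/
lemma card_lt_max_or_isomorphic {k t : ℕ} {F : Finset (Finset (Finset (Fin n)))}
    (hF : IsNontrivialIntersecting n k t F) (ht : 1 ≤ t) (hk : t + 3 ≤ k) (hkn : k < n)
    (hr : ∀ i, t ≤ i → i + 2 ≤ k →
      ((t + 1) * (k - t + 1)) ^ 2 * extensionCount n k (i + 1) ≤ extensionCount n k i) :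
    F.card < max (frankl n k t).card (hiltonMilner n k t).card ∨
      (k ≤ 2 * t + 2 ∧ Isomorphic F (frankl n k t)) ∨
      (2 * t + 2 ≤ k ∧ Isomorphic F (hiltonMilner n k t)) := by
  have hblocks : ∀ {Z : Finset (Finset (Fin n))}, IsPartition Z → (¬ ∃ B ∈ Z, 2 ≤ B.card) →
      ∀ B ∈ Z, B.card = 1 := fun hZ h B hB => by
    have h1 := (hZ.1 B hB).card_pos
    by_contra h2
    exact h ⟨B, hB, by omega⟩
  rcases card_le_or_subset hF ht hk hkn hr with h | ⟨Z, hZ, hZc, hk2, hFZ⟩ |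
    ⟨X, M, hM, hXM, hXc, hMc, hk2, hFM⟩
  · exact Or.inl (card_lt_max_of_le ht hk hkn hr h)
  · by_cases hB : ∃ B ∈ Z, 2 ≤ B.card
    · obtain ⟨B, hB, hB2⟩ := hB
      exact Or.inl (lt_max_of_lt_left ((Finset.card_le_card hFZ).trans_lt
        (card_familyA_lt ht hk hkn hr hZc hB hB2)))
    · have hiso := familyA_isomorphic_frankl k hZ (hblocks hZ hB) hZc
      rcases hFZ.eq_or_ssubset with rfl | hss
      · exact Or.inr (Or.inl ⟨hk2, hiso⟩)
      · exact Or.inl (lt_max_of_lt_left (hiso.card_eq ▸ Finset.card_lt_card hss))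
  · by_cases hB : ∃ B ∈ M, 2 ≤ B.card
    · obtain ⟨B, hB, hB2⟩ := hB
      exact Or.inl (lt_max_of_lt_right ((Finset.card_le_card hFM).trans_lt
        (card_familyH_lt ht hk hkn hr hXM hXc hMc hB hB2)))
    · have hiso := familyH_isomorphic_hiltonMilner hM (hblocks hM hB) hXM hXc hMc
      rcases hFM.eq_or_ssubset with rfl | hss
      · exact Or.inr (Or.inr ⟨hk2, hiso⟩)
      · exact Or.inl (lt_max_of_lt_right (hiso.card_eq ▸ Finset.card_lt_card hss))

/-- On the boundary `k = 2 t + 2` with `t ≥ 2`, the first-order terms agree and the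
second-order terms decide. -/
lemma card_hiltonMilner_lt_card_frankl {t : ℕ} (ht : 2 ≤ t) (hkn : 2 * t + 2 < n)
    (hr : ∀ i, t ≤ i → i + 2 ≤ 2 * t + 2 →
      ((t + 1) * (2 * t + 2 - t + 1)) ^ 2 * extensionCount n (2 * t + 2) (i + 1) ≤
        extensionCount n (2 * t + 2) i) :
    (hiltonMilner n (2 * t + 2) t).card < (frankl n (2 * t + 2) t).card := by
  have hA := card_frankl_add (t := t) (k := 2 * t + 2) (by omega) hkn
  have h0 := card_familyHMain_add_le (k := 2 * t + 2) (singletons_isPartition n (2 * t + 2))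
    (fun _ hB => card_of_mem_singletons hB)
    (singletons_mono (n := n) (by omega : t ≤ 2 * t + 2)) (card_singletons hkn.le)
  have hH := card_familyH_le (2 * t + 2) (singletons n t) (singletons n (2 * t + 2))
  rw [card_singletons (by omega : t ≤ n)] at h0 hH
  have hr2 := hr (t + 2) (by omega) (by omega)
  have hpos : 0 < extensionCount n (2 * t + 2) (t + 3) := extensionCount_pos (by omega) hkn.le
  have hd : 2 * t + 2 - t = t + 2 := by omega
  rw [hd] at h0 hr2
  have hc3 := Nat.choose_le_pow (t + 2) 3
  have hc2 : 2 * (t + 1) ≤ (t + 2).choose 2 := by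
    rw [Nat.choose_two_right, Nat.le_div_iff_mul_le (by norm_num), Nat.add_succ_sub_one]
    nlinarith
  rw [show t + 2 + 1 = t + 3 from rfl] at hr2
  change _ ≤ (familyHMain n (2 * t + 2) (singletons n t) (singletons n (2 * t + 2))).card + t at hH
  rw [hiltonMilner]
  set e1 := extensionCount n (2 * t + 2) (t + 1)
  set e2 := extensionCount n (2 * t + 2) (t + 2)
  set e3 := extensionCount n (2 * t + 2) (t + 3)
  have h1 := Nat.mul_le_mul_right e2 hc2
  have h2 := Nat.mul_le_mul_right e3 hc3
  have h3 : 2 * (t + 1) * e2 = (t + 1) * e2 + (t + 1) * e2 := by ring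
  have h4 : (t + 2) ^ 3 * e3 + t < (t + 1) * e2 :=
    calc (t + 2) ^ 3 * e3 + t ≤ (t + 2) ^ 3 * e3 + t * e3 :=
          Nat.add_le_add_left (Nat.le_mul_of_pos_right _ hpos) _
      _ = ((t + 2) ^ 3 + t) * e3 := by ring
      _ < (t + 1) * ((t + 1) * (t + 3)) ^ 2 * e3 := by
          refine Nat.mul_lt_mul_of_pos_right ?_ hpos
          have : (t + 1) * ((t + 1) * (t + 3)) ^ 2 = (t + 2) ^ 3 + t + (t ^ 5 + 9 * t ^ 4 +
            29 * t ^ 3 + 40 * t ^ 2 + 20 * t + 1) := by ring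
          omega
      _ = (t + 1) * (((t + 1) * (t + 3)) ^ 2 * e3) := by ring
      _ ≤ (t + 1) * e2 := Nat.mul_le_mul_left _ hr2
  omega

lemma card_hiltonMilner_four_one (hn : 4 < n) :
    (hiltonMilner n 4 1).card = (frankl n 4 1).card := by
  have hM := singletons_isPartition n 4
  have h1 : ∀ B ∈ singletons n 4, B.card = 1 := fun _ hB => card_of_mem_singletons hB
  have hXM : singletons n 1 ⊆ singletons n 4 := singletons_mono (by norm_num)
  have hXc : (singletons n 1).card = 1 := card_singletons (by omega)
  have hMc : (singletons n 4).card = 4 := card_singletons (by omega)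
  have hA := card_frankl_add (t := 1) (k := 4) (by norm_num) hn
  have h := card_familyHMain_four hM h1 hXM hMc hXc hn
  have z3 : extensionCount n 4 3 = 1 := by
    obtain ⟨m, rfl⟩ : ∃ m, n = m + 4 := ⟨n - 4, by omega⟩
    exact Nat.stirlingSecond_one_right m
  have hH : (hiltonMilner n 4 1).card =
      (familyHMain n 4 (singletons n 1) (singletons n 4)).card + 1 := by
    rw [hiltonMilner, familyH_eq, Finset.card_union_of_disjoint]
    · obtain ⟨C, hC⟩ := Finset.card_eq_one.1 hXc
      rw [hC, Finset.image_singleton, Finset.card_singleton]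
    · refine Finset.disjoint_left.2 fun P hP hP' => ?_
      obtain ⟨C, hC, rfl⟩ := Finset.mem_image.1 hP'
      exact notMem_enlarge (support_ne_univ hM h1 hMc hn) (hXM hC)
        ((mem_star.1 (Finset.mem_filter.1 hP).1).2 hC)
  norm_num [z3] at hA
  omega

end KPartition

theorem theorem2 (n k t : ℕ) (ht : 1 ≤ t) (hk : t + 3 ≤ k)
    (hn : 2 * KPartition.threshold k t ≤ (n : ℝ)) :
    KPartition.IsNontrivialIntersecting n k t (KPartition.frankl n k t) ∧
    KPartition.IsNontrivialIntersecting n k t (KPartition.hiltonMilner n k t) ∧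
    ∀ F : Finset (Finset (Finset (Fin n))), KPartition.IsNontrivialIntersecting n k t F →
      F.card ≤ max (KPartition.frankl n k t).card (KPartition.hiltonMilner n k t).card ∧
      (2 * t + 3 ≤ k →
        (F.card = max (KPartition.frankl n k t).card (KPartition.hiltonMilner n k t).card ↔
          KPartition.Isomorphic F (KPartition.hiltonMilner n k t))) ∧
      (k ≤ 2 * t + 2 →
        (F.card = max (KPartition.frankl n k t).card (KPartition.hiltonMilner n k t).card ↔
          KPartition.Isomorphic F (KPartition.frankl n k t) ∨
            (k = 4 ∧ t = 1 ∧ KPartition.Isomorphic F (KPartition.hiltonMilner n 4 1)))) := by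
  open KPartition in
  have hkn := lt_of_threshold_le ht hk hn
  have hr : ∀ i, t ≤ i → i + 2 ≤ k →
      ((t + 1) * (k - t + 1)) ^ 2 * extensionCount n k (i + 1) ≤ extensionCount n k i :=
    fun i hi hik => sq_mul_stirlingSecond_le ht hk hn hi hik
  have hlt : extensionCount n k (t + 2) < extensionCount n k (t + 1) := by
    obtain ⟨h1, h2, -, h4⟩ := error_terms_le ht hk hkn hr
    have := Nat.le_mul_of_pos_left
      ((k - t + 1) * ((k - t + 1) * extensionCount n k (t + 2))) (by omega : 0 < t + 1)
    omega
  have hAn : IsNontrivialIntersecting n k t (frankl n k t) :=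
    familyA_isNontrivialIntersecting (singletons_isPartition _ _)
      (fun _ hB => card_of_mem_singletons hB) (card_singletons (by omega)) ht hk hlt
  have hHn : IsNontrivialIntersecting n k t (hiltonMilner n k t) :=
    familyH_isNontrivialIntersecting (singletons_isPartition _ _)
      (fun _ hB => card_of_mem_singletons hB) (singletons_mono (by omega))
      (card_singletons (by omega)) (card_singletons hkn.le) ht hk hkn hlt
  refine ⟨hAn, hHn, fun F hF => ?_⟩
  have hA := card_lt_max_or_isomorphic hAn ht hk hkn hr
  have hH := card_lt_max_or_isomorphic hHn ht hk hkn hr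
  have hmain := card_lt_max_or_isomorphic hF ht hk hkn hr
  refine ⟨?_, fun hk2 => ?_, fun hk2 => ?_⟩
  · rcases hmain with h | ⟨-, h⟩ | ⟨-, h⟩
    · exact h.le
    · exact h.card_eq.trans_le (le_max_left _ _)
    · exact h.card_eq.trans_le (le_max_right _ _)
  · -- the alternative, applied to the Frankl-type family itself, compares the two families
    have hle : (frankl n k t).card ≤ (hiltonMilner n k t).card := by
      rcases hA with h | ⟨h, -⟩ | ⟨-, h⟩
      · rcases lt_max_iff.1 h with h | h
        · exact (lt_irrefl _ h).elim
        · exact h.le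
      · omega
      · exact h.card_eq.le
    rw [max_eq_right hle] at hmain ⊢
    refine ⟨fun h => ?_, fun h => h.card_eq⟩
    rcases hmain with h' | ⟨h', -⟩ | ⟨-, h'⟩
    · omega
    · omega
    · exact h'
  · have hle : (hiltonMilner n k t).card ≤ (frankl n k t).card ∧
        (2 * t + 2 ≤ k → t ≠ 1 → (hiltonMilner n k t).card < (frankl n k t).card) := by
      rcases hk2.eq_or_lt with rfl | hk3
      · by_cases ht1 : t = 1
        · subst ht1
          exact ⟨(card_hiltonMilner_four_one hkn).le, fun _ h => (h rfl).elim⟩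
        · have := card_hiltonMilner_lt_card_frankl (by omega) hkn hr
          exact ⟨this.le, fun _ _ => this⟩
      · refine ⟨?_, fun h => by omega⟩
        rcases hH with h | ⟨-, h⟩ | ⟨h, -⟩
        · rcases lt_max_iff.1 h with h | h
          · exact h.le
          · exact (lt_irrefl _ h).elim
        · exact h.card_eq.le
        · omega
    rw [max_eq_left hle.1] at hmain ⊢
    constructor
    · intro h
      rcases hmain with h' | ⟨-, h'⟩ | ⟨h', hiso⟩
      · omega
      · exact Or.inl h'
      · right
        have ht1 : t = 1 := by
          by_contra hne
          have := hle.2 h' hne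
          have := hiso.card_eq
          omega
        obtain rfl : k = 4 := by omega
        subst ht1
        exact ⟨rfl, rfl, hiso⟩
    · rintro (h | ⟨rfl, rfl, h⟩)
      · exact h.card_eq
      · rw [h.card_eq, card_hiltonMilner_four_one hkn]
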